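/- Let $d\ge 1$, let $\Omega\subset\mathbb R^d$ be open and bounded, let $c(x,y)=\|x-y\|^2$, and for $x\in\Omega$ let $c_\partial(x)=\inf_{y\in\partial\Omega}c(x,y)$. Let $\varepsilon>0$, and let $\alpha,\beta$ be nonzero locally finite Borel measures on $\Omega$ (possibly of infinite total mass) with $\int_\Omega c_\partial\,d\alpha<\infty$ and $\int_\Omega c_\partial\,d\beta<\infty$. Put $\hat\alpha=c_\partial\,\alpha$ and $\hat\beta=c_\partial\,\beta$; these are nonzero finite measures. Write $m(\cdot)$ for total mass, and set $$m_g=\sqrt{m(\hat\alpha)\,m(\hat\beta)},\qquad m_h=2\left(\frac1{m(\hat\alpha)}+\frac1{m(\hat\beta)}\right)^{-1}.$$ Let $\varphi(x,z)=|1-c_\partial(x)z|$ if $0\le z\le 1/c_\partial(x)$ and $\varphi(x,z)=+\infty$ otherwise. For a measure $\pi$ on $\Omega\times\Omega$ with marginals $\pi_1,\pi_2$, let $$R(\pi|\hat\alpha,\hat\beta)=\tfrac12\left(\mathrm{KL}\left(\pi\,\Big|\,\tfrac{\hat\alpha}{m(\hat\alpha)}\otimes\hat\beta\right)+\mathrm{KL}\left(\pi\,\Big|\,\hat\alpha\otimes\tfrac{\hat\beta}{m(\hat\beta)}\right)\right),$$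 where $\mathrm{KL}(\pi|\nu)=\int\left(\frac{d\pi}{d\nu}\log\frac{d\pi}{d\nu}-\frac{d\pi}{d\nu}+1\right)d\nu$ if $\pi\ll\nu$ and $\mathrm{KL}(\pi|\nu)=+\infty$ otherwise. Define the regularized optimal transport cost with boundary by $$\mathrm{FG}_\varepsilon(\alpha,\beta)=\inf_{\pi}\ \int c\,d\pi+\int_\Omega\varphi\left(x,\frac{d\pi_1}{d\hat\alpha}(x)\right)d\hat\alpha(x)+\int_\Omega\varphi\left(y,\frac{d\pi_2}{d\hat\beta}(y)\right)d\hat\beta(y)+\varepsilon R(\pi|\hat\alpha,\hat\beta),\tag{P}$$ where the infimum is over all locally finite (nonnegative) Borel measures $\pi$ on $\Omega\times\Omega$, and each of the two $\varphi$-terms is $+\infty$ when the corresponding marginal is not absolutely continuous with respect to $\hat\alpha$, respectively $\hat\beta$. Then $$\mathrm{FG}_\varepsilon(\alpha,\beta)=\sup_{f,g\in C(\Omega)}\ \int_\Omega\min\left(1,\frac{f}{c_\partial}\right)d\hat\alpha+\int_\Omega\min\left(1,\frac{g}{c_\partial}\right)d\hat\beta-\varepsilon\int_{\Omega\times\Omega}\left(\frac{e^{(f(x)+g(y)-c(x,y))/\varepsilon}}{m_g}-\frac1{m_h}\right)d(\hat\alpha\otimes\hat\beta)(x,y),\tag{D}$$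 where $C(\Omega)$ is the set of all continuous real functions on $\Omega$ and the objective of (D) takes values in $[-\infty,+\infty)$. Furthermore, if $(f,g)\in C(\Omega)^2$ attains the supremum in (D), then $$\pi=\frac{e^{(f(x)+g(y)-c(x,y))/\varepsilon}}{m_g}\;\hat\alpha\otimes\hat\beta$$ attains the infimum in (P). -/

import Mathlib

open MeasureTheory Set
open scoped ENNReal

noncomputable section

namespace ROTB

/-- The ambient Euclidean space `ℝ^d`. -/
abbrev E (d : ℕ) : Type := EuclideanSpace ℝ (Fin d)

/-- The transport cost `c(x, y) = ‖x - y‖²`. -/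
def cost {d : ℕ} (x y : E d) : ℝ := ‖x - y‖ ^ 2

/-- The cost of moving `x` to the boundary of `Ω`: `c_∂(x) = inf_{y ∈ ∂Ω} c(x, y)`. -/
def bdryCost {d : ℕ} (Ω : Set (E d)) (x : E d) : ℝ := ⨅ y : frontier Ω, cost x y

/-- The total persistence `∫_Ω c_∂ dμ`. -/
def totalPersistence {d : ℕ} {Ω : Set (E d)} (μ : Measure Ω) : ℝ≥0∞ :=
  ∫⁻ x : Ω, ENNReal.ofReal (bdryCost Ω x) ∂μ

/-- The class `𝓜^c(Ω)`: locally finite measures on `Ω` (their total mass may be infinite)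
with finite total persistence. -/
structure FinitePersistence {d : ℕ} {Ω : Set (E d)} (μ : Measure Ω) : Prop where
  locallyFinite : IsLocallyFiniteMeasure μ
  finite_pers : totalPersistence μ < ∞

/-- The renormalized measure `μ̂ = c_∂ μ`. -/
def renorm {d : ℕ} {Ω : Set (E d)} (μ : Measure Ω) : Measure Ω :=
  μ.withDensity fun x => ENNReal.ofReal (bdryCost Ω x)

/-- The geometric mean of the total masses of two finite measures. -/
def geomMass {X Y : Type*} [MeasurableSpace X] [MeasurableSpace Y]
    (μ : Measure X) (ν : Measure Y) : ℝ :=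
  Real.sqrt (μ.real univ * ν.real univ)

/-- The harmonic mean of the total masses of two (nonzero) finite measures. -/
def harmMass {X Y : Type*} [MeasurableSpace X] [MeasurableSpace Y]
    (μ : Measure X) (ν : Measure Y) : ℝ :=
  2 * (1 / μ.real univ + 1 / ν.real univ)⁻¹

/-- The spatially varying entropy function: `φ(x, z) = |1 - c_∂(x) z|` if `0 ≤ z ≤ 1 / c_∂(x)`,
and `+∞` otherwise. -/
def phi {d : ℕ} (Ω : Set (E d)) (x : E d) (z : ℝ≥0∞) : ℝ≥0∞ :=
  open scoped Classical in
  if z ≤ 1 / ENNReal.ofReal (bdryCost Ω x) then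
    ENNReal.ofReal |1 - bdryCost Ω x * z.toReal|
  else ∞

/-- The marginal penalty `∫ φ(x, dρ/dν (x)) dν(x)`, equal to `+∞` if `ρ` is not absolutely
continuous with respect to `ν`. -/
def marginalPenalty {d : ℕ} {Ω : Set (E d)} (ρ ν : Measure Ω) : ℝ≥0∞ :=
  open scoped Classical in
  if ρ ≪ ν then ∫⁻ x : Ω, phi Ω x (ρ.rnDeriv ν x) ∂ν else ∞

/-- The homogeneous entropic regularization
`R(π | μ, ν) = (KL(π | μ/m(μ) ⊗ ν) + KL(π | μ ⊗ ν/m(ν))) / 2`. Here `KL` is the divergence of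
`p ↦ p log p - p + 1`, so it contains the correction by the total masses. -/
def entropicReg {X Y : Type*} [MeasurableSpace X] [MeasurableSpace Y]
    (π : Measure (X × Y)) (μ : Measure X) (ν : Measure Y) : ℝ≥0∞ :=
  (1 / 2) * (InformationTheory.klDiv π (((μ univ)⁻¹ • μ).prod ν)
    + InformationTheory.klDiv π (μ.prod ((ν univ)⁻¹ • ν)))

/-- The primal objective at a plan `π`. -/
def primalObj {d : ℕ} {Ω : Set (E d)} (ε : ℝ) (α β : Measure Ω) (π : Measure (Ω × Ω)) : ℝ≥0∞ :=
  (∫⁻ p : Ω × Ω, ENNReal.ofReal (cost (p.1 : E d) p.2) ∂π)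
    + marginalPenalty (π.map Prod.fst) (renorm α)
    + marginalPenalty (π.map Prod.snd) (renorm β)
    + ENNReal.ofReal ε * entropicReg π (renorm α) (renorm β)

/-- The regularized transport cost with boundary: the infimum of the primal objective over all
(locally finite) measures on `Ω × Ω`. -/
def FG {d : ℕ} {Ω : Set (E d)} (ε : ℝ) (α β : Measure Ω) : ℝ≥0∞ :=
  ⨅ (π : Measure (Ω × Ω)) (_ : IsLocallyFiniteMeasure π), primalObj ε α β π

/-- `π` attains the infimum that defines the primal problem. -/
def IsPrimalOptimal {d : ℕ} {Ω : Set (E d)} (ε : ℝ) (α β : Measure Ω)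
    (π : Measure (Ω × Ω)) : Prop :=
  IsLocallyFiniteMeasure π ∧ primalObj ε α β π = FG ε α β

/-- The integral `∫ h⁺ dμ - ∫ h⁻ dμ` in `[-∞, +∞]`. It is used below only for functions that are
bounded from one side and for finite measures, so that `+∞ - ∞` does not occur. -/
def extIntegral {X : Type*} [MeasurableSpace X] (μ : Measure X) (h : X → ℝ) : EReal :=
  ((∫⁻ x, ENNReal.ofReal (h x) ∂μ : ℝ≥0∞) : EReal)
    - ((∫⁻ x, ENNReal.ofReal (-h x) ∂μ : ℝ≥0∞) : EReal)

/-- The Gibbs kernel `exp ((f(x) + g(y) - c(x, y)) / ε)`. -/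
def gibbs {d : ℕ} {Ω : Set (E d)} (ε : ℝ) (f g : C(Ω, ℝ)) (p : Ω × Ω) : ℝ :=
  Real.exp ((f p.1 + g p.2 - cost (p.1 : E d) p.2) / ε)

/-- The dual objective, with values in `[-∞, +∞)`:
`⟨min(1, f/c_∂), α̂⟩ + ⟨min(1, g/c_∂), β̂⟩ - ε ⟨e^{(f ⊕ g - c)/ε} / m_g - 1 / m_h, α̂ ⊗ β̂⟩`. -/
def dualObj {d : ℕ} {Ω : Set (E d)} (ε : ℝ) (α β : Measure Ω) (f g : C(Ω, ℝ)) : EReal :=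
  extIntegral (renorm α) (fun x => min 1 (f x / bdryCost Ω x))
    + extIntegral (renorm β) (fun y => min 1 (g y / bdryCost Ω y))
    - (ε : EReal) * extIntegral ((renorm α).prod (renorm β))
        (fun p => gibbs ε f g p / geomMass (renorm α) (renorm β)
          - 1 / harmMass (renorm α) (renorm β))

/-- `(f, g)` attains the supremum of the dual objective. -/
def IsDualOptimal {d : ℕ} {Ω : Set (E d)} (ε : ℝ) (α β : Measure Ω) (f g : C(Ω, ℝ)) : Prop :=
  ∀ f' g' : C(Ω, ℝ), dualObj ε α β f' g' ≤ dualObj ε α β f g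

/-- The plan `e^{(f ⊕ g - c)/ε} α̂ ⊗ β̂ / m_g`. -/
def gibbsPlan {d : ℕ} {Ω : Set (E d)} (ε : ℝ) (α β : Measure Ω) (f g : C(Ω, ℝ)) :
    Measure (Ω × Ω) :=
  ((renorm α).prod (renorm β)).withDensity fun p =>
    ENNReal.ofReal (gibbs ε f g p / geomMass (renorm α) (renorm β))

end ROTB

end

/-! Duality comes from an exact formula for the gap, not from a minimax theorem. For a plan of
finite primal cost and potentials of finite dual value, the primal value minus the dual value is a
sum of three integrals of pointwise Fenchel slacks: one `marginalGap` for each marginal and one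
`planGap` for the entropy (`toReal_primalObj_eq_add`). All three are nonnegative, which is weak
duality. The delicate point is integrability, since the plan is only locally finite and the
potentials may be unbounded: finite entropy forces finite mass, the marginal constraint controls the
negative parts of the potentials, and the entropy slack controls the rest.

There is no gap because some pair of potentials makes every slack vanish. Optimizing one potential
with the other fixed gives the explicit map `sinkhorn`. It reverses order, so its two-step
composition is monotone, and iterating from a constant upper bound gives a decreasing sequence,
bounded below, whose limit solves both optimality equations (`exists_sinkhorn_fixedPoint`). At such
a solution the marginals of the Gibbs plan satisfy complementary slackness (`sinkhorn_marginal`).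

For an arbitrary dual maximizer, take the optimal plan already constructed. Its gap to the maximizer
is zero, and the entropy slack is strictly positive wherever the density is not the Gibbs density,
so this plan is the Gibbs plan of the maximizer (`eq_gibbsPlan_of_dualObj_eq`). -/

namespace ROTB

/-! ### The homogeneous entropy as a single relative entropy with respect to the product measure. -/

section Entropy

variable {X Y : Type*} [MeasurableSpace X] [MeasurableSpace Y]

/-- Split at density `e`: below it the mass is at most `e` times that of the finite `P`, above it
the log-likelihood ratio is at least 1 and dominates the mass. This is how a merely locally finite
competitor is seen to be finite. -/
theorem isFiniteMeasure_of_integrable_llr {π P : Measure X} [SigmaFinite π] [IsFiniteMeasure P]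
    (hac : π ≪ P) (hint : Integrable (llr π P) π) : IsFiniteMeasure π := by
  have hm := Measure.measurable_rnDeriv π P
  have h1 : ∫⁻ x, ‖llr π P x‖ₑ ∂π < ∞ := hint.2
  set S : Set X := {x | π.rnDeriv P x ≤ ENNReal.ofReal (Real.exp 1)} with hS
  have hSm : MeasurableSet S := measurableSet_le hm measurable_const
  have hS1 : π S < ∞ := by
    rw [← Measure.setLIntegral_rnDeriv hac]
    calc ∫⁻ x in S, π.rnDeriv P x ∂P ≤ ∫⁻ x in S, ENNReal.ofReal (Real.exp 1) ∂P :=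
          setLIntegral_mono measurable_const fun x hx => hx
      _ < ∞ := by
          rw [setLIntegral_const]
          exact ENNReal.mul_lt_top ENNReal.ofReal_lt_top (measure_lt_top _ _)
  have hS2 : π Sᶜ < ∞ := by
    refine lt_of_le_of_lt ?_ h1
    calc π Sᶜ = ∫⁻ x in Sᶜ, 1 ∂π := by simp
      _ ≤ ∫⁻ x in Sᶜ, ‖llr π P x‖ₑ ∂π := by
          refine lintegral_mono_ae ?_
          filter_upwards [ae_restrict_mem hSm.compl,
            ae_restrict_of_ae (hac.ae_le (Measure.rnDeriv_lt_top π P))] with x hx hxt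
          have hx' : ENNReal.ofReal (Real.exp 1) < π.rnDeriv P x := not_le.1 hx
          have h2 : Real.exp 1 ≤ (π.rnDeriv P x).toReal :=
            (ENNReal.ofReal_le_iff_le_toReal hxt.ne).1 hx'.le
          have h3 : 1 ≤ llr π P x := by
            rw [llr_def, Real.le_log_iff_exp_le (lt_of_lt_of_le (Real.exp_pos _) h2)]
            exact h2
          rw [← ofReal_norm, ENNReal.one_le_ofReal]
          exact h3.trans (le_abs_self _)
      _ ≤ ∫⁻ x, ‖llr π P x‖ₑ ∂π := setLIntegral_le_lintegral _ _
  refine ⟨?_⟩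
  rw [← measure_add_measure_compl hSm]
  exact ENNReal.add_lt_top.2 ⟨hS1, hS2⟩

theorem smul_prod_eq (μ : Measure X) (ν : Measure Y) [SFinite μ] [SFinite ν] (c : ℝ≥0∞) :
    (c • μ).prod ν = c • μ.prod ν ∧ μ.prod (c • ν) = c • μ.prod ν :=
  ⟨Measure.prod_smul_left c, Measure.prod_smul_right c⟩

theorem integrable_llr_smul_right {π P : Measure X} [IsFiniteMeasure π] [IsFiniteMeasure P]
    (hac : π ≪ P) {c : ℝ≥0∞} (hc0 : c ≠ 0) (hc : c ≠ ∞) :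
    Integrable (llr π (c • P)) π ↔ Integrable (llr π P) π := by
  rw [integrable_congr (llr_smul_right hac c hc0 hc)]
  exact ⟨fun h => (h.add (integrable_const (Real.log c.toReal))).congr (ae_of_all _ fun x => by simp),
    fun h => h.sub (integrable_const _)⟩

theorem toReal_klDiv_smul_right_eq {π P : Measure X} [IsFiniteMeasure π] [IsFiniteMeasure P]
    (hac : π ≪ P) (hint : Integrable (llr π P) π) {c : ℝ≥0∞} (hc0 : c ≠ 0) (hc : c ≠ ∞) :
    (InformationTheory.klDiv π (c • P)).toReal
      = ∫ x, llr π P x ∂π - Real.log c.toReal * π.real univ + c.toReal * P.real univ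
        - π.real univ := by
  have hac' : π ≪ c • P := hac.trans (Measure.absolutelyContinuous_smul hc0)
  have : IsFiniteMeasure (c • P) := Measure.smul_finite P hc
  rw [InformationTheory.toReal_klDiv hac' ((integrable_llr_smul_right hac hc0 hc).2 hint),
    integral_congr_ae (llr_smul_right hac c hc0 hc), integral_sub hint (integrable_const _),
    integral_const, measureReal_ennreal_smul_apply, smul_eq_mul, mul_comm (Real.log _)]

variable {μ : Measure X} {ν : Measure Y} [IsFiniteMeasure μ] [IsFiniteMeasure ν]
  {π : Measure (X × Y)}

/-- Both reference measures are positive finite multiples of `μ.prod ν`, and rescaling only shifts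
the log-likelihood ratio by a constant. -/
theorem entropicReg_ne_top_iff [SigmaFinite π] (hμ : μ ≠ 0) (hν : ν ≠ 0) :
    entropicReg π μ ν ≠ ∞ ↔
      IsFiniteMeasure π ∧ π ≪ μ.prod ν ∧ Integrable (llr π (μ.prod ν)) π := by
  have hμ0 : (μ univ)⁻¹ ≠ 0 := ENNReal.inv_ne_zero.2 (measure_ne_top _ _)
  have hμt : (μ univ)⁻¹ ≠ ∞ := ENNReal.inv_ne_top.2 (by simpa using hμ)
  have hν0 : (ν univ)⁻¹ ≠ 0 := ENNReal.inv_ne_zero.2 (measure_ne_top _ _)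
  have hνt : (ν univ)⁻¹ ≠ ∞ := ENNReal.inv_ne_top.2 (by simpa using hν)
  have hP : ∀ {c : ℝ≥0∞}, c ≠ 0 → (π ≪ c • μ.prod ν ↔ π ≪ μ.prod ν) := fun {c} hc =>
    ⟨fun h => h.trans Measure.smul_absolutelyContinuous,
      fun h => h.trans (Measure.absolutelyContinuous_smul hc)⟩
  have key : entropicReg π μ ν ≠ ∞ ↔
      InformationTheory.klDiv π ((μ univ)⁻¹ • μ.prod ν) ≠ ∞ ∧
      InformationTheory.klDiv π ((ν univ)⁻¹ • μ.prod ν) ≠ ∞ := by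
    rw [entropicReg, (smul_prod_eq μ ν _).1, (smul_prod_eq μ ν _).2, ← not_or, Ne, not_iff_not,
      ENNReal.mul_eq_top, ENNReal.add_eq_top]
    simp
  rw [key, InformationTheory.klDiv_ne_top_iff, InformationTheory.klDiv_ne_top_iff, hP hμ0, hP hν0]
  constructor
  · rintro ⟨⟨h1, h2⟩, -⟩
    have : IsFiniteMeasure ((μ univ)⁻¹ • μ.prod ν) := Measure.smul_finite _ hμt
    have hfin : IsFiniteMeasure π := isFiniteMeasure_of_integrable_llr ((hP hμ0).2 h1) h2
    exact ⟨hfin, h1, (integrable_llr_smul_right h1 hμ0 hμt).1 h2⟩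
  · rintro ⟨h0, h1, h2⟩
    exact ⟨⟨h1, (integrable_llr_smul_right h1 hμ0 hμt).2 h2⟩,
      ⟨h1, (integrable_llr_smul_right h1 hν0 hνt).2 h2⟩⟩

theorem geomMass_pos (hμ : μ ≠ 0) (hν : ν ≠ 0) : 0 < geomMass μ ν := by
  have : NeZero μ := ⟨hμ⟩
  have : NeZero ν := ⟨hν⟩
  exact Real.sqrt_pos.2 (mul_pos measureReal_univ_pos measureReal_univ_pos)

theorem log_geomMass (hμ : μ ≠ 0) (hν : ν ≠ 0) :
    Real.log (geomMass μ ν) = (Real.log (μ.real univ) + Real.log (ν.real univ)) / 2 := by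
  have : NeZero μ := ⟨hμ⟩
  have : NeZero ν := ⟨hν⟩
  have h1 : 0 < μ.real univ := measureReal_univ_pos
  have h2 : 0 < ν.real univ := measureReal_univ_pos
  rw [geomMass, Real.log_sqrt (by positivity), Real.log_mul h1.ne' h2.ne']

/-- Source of the two means: averaging the two logarithms of masses gives the log of the geometric
mean, averaging the two inverse masses gives the inverse of the harmonic mean. -/
theorem toReal_entropicReg [IsFiniteMeasure π] (hμ : μ ≠ 0) (hν : ν ≠ 0)
    (hac : π ≪ μ.prod ν) (hint : Integrable (llr π (μ.prod ν)) π) :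
    (entropicReg π μ ν).toReal = ∫ p, llr π (μ.prod ν) p ∂π
      + (Real.log (geomMass μ ν) - 1) * π.real univ
      + 1 / harmMass μ ν * (μ.prod ν).real univ := by
  have hμ0 : (μ univ)⁻¹ ≠ 0 := ENNReal.inv_ne_zero.2 (measure_ne_top _ _)
  have hμt : (μ univ)⁻¹ ≠ ∞ := ENNReal.inv_ne_top.2 (by simpa using hμ)
  have hν0 : (ν univ)⁻¹ ≠ 0 := ENNReal.inv_ne_zero.2 (measure_ne_top _ _)
  have hνt : (ν univ)⁻¹ ≠ ∞ := ENNReal.inv_ne_top.2 (by simpa using hν)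
  have hk : ∀ {c : ℝ≥0∞}, c ≠ 0 → c ≠ ∞ → InformationTheory.klDiv π (c • μ.prod ν) ≠ ∞ :=
    fun {c} h0 ht => InformationTheory.klDiv_ne_top
      (hac.trans (Measure.absolutelyContinuous_smul h0))
      ((integrable_llr_smul_right hac h0 ht).2 hint)
  rw [entropicReg, (smul_prod_eq μ ν _).1, (smul_prod_eq μ ν _).2, ENNReal.toReal_mul,
    ENNReal.toReal_add (hk hμ0 hμt) (hk hν0 hνt), toReal_klDiv_smul_right_eq hac hint hμ0 hμt,
    toReal_klDiv_smul_right_eq hac hint hν0 hνt, log_geomMass hμ hν, harmMass]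
  simp only [ENNReal.toReal_inv, Real.log_inv, Measure.real, ENNReal.toReal_ofNat, mul_inv, one_div, inv_inv]
  ring

end Entropy

/-! ### Extended integrals of functions bounded on one side. -/

section ExtIntegral

variable {X : Type*} [MeasurableSpace X] {μ : Measure X} {h : X → ℝ}

theorem extIntegral_of_integrable (hh : Integrable h μ) :
    extIntegral μ h = ((∫ x, h x ∂μ : ℝ) : EReal) := by
  have h1 : ∫⁻ x, ENNReal.ofReal (h x) ∂μ ≠ ∞ := hh.lintegral_lt_top.ne
  have h2 : ∫⁻ x, ENNReal.ofReal (-h x) ∂μ ≠ ∞ := hh.neg.lintegral_lt_top.ne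
  rw [extIntegral, integral_eq_lintegral_pos_part_sub_lintegral_neg_part hh, EReal.coe_sub,
    EReal.coe_ennreal_toReal h1, EReal.coe_ennreal_toReal h2]

theorem lintegral_ofReal_ne_top_of_le [IsFiniteMeasure μ] {C : ℝ} (hC : ∀ x, h x ≤ C) :
    ∫⁻ x, ENNReal.ofReal (h x) ∂μ ≠ ∞ := by
  refine ne_top_of_le_ne_top (b := ENNReal.ofReal C * μ univ) ?_ ?_
  · exact ENNReal.mul_ne_top ENNReal.ofReal_ne_top (measure_ne_top _ _)
  · rw [← lintegral_const]
    exact lintegral_mono fun x => ENNReal.ofReal_le_ofReal (hC x)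

theorem integrable_of_lintegral_ofReal_ne_top (hm : Measurable h)
    (h1 : ∫⁻ x, ENNReal.ofReal (h x) ∂μ ≠ ∞) (h2 : ∫⁻ x, ENNReal.ofReal (-h x) ∂μ ≠ ∞) :
    Integrable h μ := by
  refine ⟨hm.aestronglyMeasurable, ?_⟩
  refine lt_of_le_of_lt ?_ (ENNReal.add_lt_top.2 ⟨h1.lt_top, h2.lt_top⟩)
  rw [← lintegral_add_left hm.ennreal_ofReal]
  refine lintegral_mono fun x => ?_
  rw [← ofReal_norm, Real.norm_eq_abs]
  rcases abs_cases (h x) with ⟨h3, -⟩ | ⟨h3, -⟩ <;> rw [h3]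
  · exact le_self_add
  · exact le_add_self

theorem extIntegral_of_le [IsFiniteMeasure μ] (hm : Measurable h) {C : ℝ} (hC : ∀ x, h x ≤ C) :
    extIntegral μ h = ⊥ ∨ Integrable h μ := by
  by_cases hi : ∫⁻ x, ENNReal.ofReal (-h x) ∂μ = ∞
  · left
    rw [extIntegral, hi, EReal.coe_ennreal_top, EReal.sub_top]
  · exact Or.inr (integrable_of_lintegral_ofReal_ne_top hm (lintegral_ofReal_ne_top_of_le hC) hi)

theorem extIntegral_of_ge [IsFiniteMeasure μ] (hm : Measurable h) {C : ℝ} (hC : ∀ x, C ≤ h x) :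
    extIntegral μ h = ⊤ ∨ Integrable h μ := by
  have hneg : ∫⁻ x, ENNReal.ofReal (-h x) ∂μ ≠ ∞ :=
    lintegral_ofReal_ne_top_of_le (C := -C) fun x => neg_le_neg (hC x)
  by_cases hi : ∫⁻ x, ENNReal.ofReal (h x) ∂μ = ∞
  · left
    rw [extIntegral, hi, EReal.coe_ennreal_top]
    lift ∫⁻ x, ENNReal.ofReal (-h x) ∂μ to NNReal using hneg with r
    exact EReal.top_sub_coe _
  · exact Or.inr (integrable_of_lintegral_ofReal_ne_top hm hi hneg)

end ExtIntegral

/-! ### Geometry of the domain: regularity and bounds of the costs. -/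

section Domain

variable {d : ℕ} {Ω : Set (E d)}

theorem cost_nonneg (x y : E d) : 0 ≤ cost x y := sq_nonneg _

theorem cost_comm (x y : E d) : cost x y = cost y x := by
  rw [cost, cost, norm_sub_rev]

theorem continuous_cost : Continuous fun p : Ω × Ω => cost (p.1 : E d) p.2 := by
  unfold cost
  fun_prop

theorem exists_cost_le (hb : Bornology.IsBounded Ω) : ∃ C, ∀ x y : Ω, cost (x : E d) y ≤ C := by
  obtain ⟨C, hC⟩ := Metric.isBounded_iff.1 hb
  refine ⟨C ^ 2, fun x y => ?_⟩
  have h := hC x.2 y.2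
  rw [dist_eq_norm] at h
  exact pow_le_pow_left₀ (norm_nonneg _) h 2

theorem nonempty_frontier (hd : 0 < d) (hb : Bornology.IsBounded Ω) (hne : Ω.Nonempty) :
    (frontier Ω).Nonempty := by
  have : Nonempty (Fin d) := ⟨⟨0, hd⟩⟩
  rw [nonempty_frontier_iff]
  refine ⟨hne, fun h => ?_⟩
  rw [h] at hb
  exact NormedSpace.unbounded_univ ℝ (E d) hb

/-- The distance to the closed frontier is attained, so the infimum commutes with squaring.
Positivity, continuity and boundedness of `bdryCost` are all read off from the distance function. -/
theorem bdryCost_eq_infDist_sq (hne : (frontier Ω).Nonempty) (x : E d) :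
    bdryCost Ω x = Metric.infDist x (frontier Ω) ^ 2 := by
  have : Nonempty (frontier Ω) := hne.to_subtype
  refine le_antisymm ?_ ?_
  · obtain ⟨y, hy, hxy⟩ := isClosed_frontier.exists_infDist_eq_dist hne x
    rw [hxy, dist_eq_norm]
    exact ciInf_le ⟨0, by rintro _ ⟨z, rfl⟩; exact cost_nonneg _ _⟩ (⟨y, hy⟩ : frontier Ω)
  · refine le_ciInf fun y => ?_
    rw [cost, ← dist_eq_norm]
    exact pow_le_pow_left₀ Metric.infDist_nonneg (Metric.infDist_le_dist_of_mem y.2) 2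

theorem bdryCost_pos (hne : (frontier Ω).Nonempty) (ho : IsOpen Ω) (x : Ω) :
    0 < bdryCost Ω x := by
  rw [bdryCost_eq_infDist_sq hne]
  refine pow_pos ((isClosed_frontier.notMem_iff_infDist_pos hne).1 fun h => ?_) 2
  rw [ho.frontier_eq] at h
  exact h.2 x.2

theorem continuous_bdryCost (hne : (frontier Ω).Nonempty) :
    Continuous fun x : Ω => bdryCost Ω x := by
  simp_rw [bdryCost_eq_infDist_sq hne]
  exact ((Metric.continuous_infDist_pt _).comp continuous_subtype_val).pow 2

theorem exists_bdryCost_le (hne : (frontier Ω).Nonempty) (hb : Bornology.IsBounded Ω) :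
    ∃ M, ∀ x : Ω, bdryCost Ω x ≤ M := by
  obtain ⟨y, hy⟩ := hne
  obtain ⟨C, hC⟩ := Metric.isBounded_iff.1 hb.closure
  refine ⟨C ^ 2, fun x => ?_⟩
  rw [bdryCost_eq_infDist_sq ⟨y, hy⟩]
  exact pow_le_pow_left₀ Metric.infDist_nonneg ((Metric.infDist_le_dist_of_mem hy).trans
    (hC (subset_closure x.2) (frontier_subset_closure hy))) 2

theorem isFiniteMeasure_renorm {μ : Measure Ω} (h : FinitePersistence μ) :
    IsFiniteMeasure (renorm μ) :=
  isFiniteMeasure_withDensity h.finite_pers.ne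

theorem renorm_ne_zero (hw : ∀ x : Ω, 0 < bdryCost Ω x)
    (hwc : Continuous fun x : Ω => bdryCost Ω x) {μ : Measure Ω} (hμ : μ ≠ 0) :
    renorm μ ≠ 0 := by
  intro h
  rw [renorm, withDensity_eq_zero_iff hwc.measurable.ennreal_ofReal.aemeasurable] at h
  refine hμ (ae_eq_bot.1 (Filter.eventually_false_iff_eq_bot.1 ?_))
  filter_upwards [h] with x hx
  exact (ENNReal.ofReal_pos.2 (hw x)).ne' hx

end Domain

/-! ### The marginal penalty and its Fenchel inequality. -/

section Marginal

variable {d : ℕ} {Ω : Set (E d)} {ρ ν : Measure Ω}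

theorem le_one_div_ofReal_iff {w : ℝ} (hw : 0 < w) {z : ℝ≥0∞} :
    z ≤ 1 / ENNReal.ofReal w ↔ z ≠ ∞ ∧ w * z.toReal ≤ 1 := by
  have h : (1 / ENNReal.ofReal w) = ENNReal.ofReal (1 / w) := by
    rw [ENNReal.ofReal_div_of_pos hw, ENNReal.ofReal_one]
  rw [h]
  constructor
  · intro hz
    have hz' : z ≠ ∞ := ne_top_of_le_ne_top ENNReal.ofReal_ne_top hz
    refine ⟨hz', ?_⟩
    rw [ENNReal.le_ofReal_iff_toReal_le hz' (by positivity), le_div_iff₀ hw] at hz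
    linarith
  · rintro ⟨hz', hz⟩
    rw [ENNReal.le_ofReal_iff_toReal_le hz' (by positivity), le_div_iff₀ hw]
    linarith

/-- Under the constraint the integrand lies in `[0, 1]` and `ν` is finite, so the constraint is the
only obstruction to finiteness. -/
theorem marginalPenalty_ne_top_iff [IsFiniteMeasure ρ] [IsFiniteMeasure ν]
    (hw : ∀ x : Ω, 0 < bdryCost Ω x) (hwc : Continuous fun x : Ω => bdryCost Ω x) :
    marginalPenalty ρ ν ≠ ∞ ↔
      ρ ≪ ν ∧ ∀ᵐ x : Ω ∂ν, bdryCost Ω x * (ρ.rnDeriv ν x).toReal ≤ 1 := by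
  have hm := Measure.measurable_rnDeriv ρ ν
  have hwm := hwc.measurable
  rw [marginalPenalty]
  split_ifs with hac
  · simp only [hac, true_and]
    constructor
    · intro h
      have hmeas : Measurable fun x : Ω => phi Ω x (ρ.rnDeriv ν x) := by
        unfold phi
        refine Measurable.ite (measurableSet_le hm ?_) ?_ measurable_const
        · exact measurable_const.div hwm.ennreal_ofReal
        · exact (measurable_const.sub (hwm.mul hm.ennreal_toReal)).abs.ennreal_ofReal
      filter_upwards [ae_lt_top hmeas h] with x hx
      unfold phi at hx
      split_ifs at hx with hz
      · exact ((le_one_div_ofReal_iff (hw x)).1 hz).2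
      · exact absurd hx (lt_irrefl _)
    · intro h
      refine ne_top_of_le_ne_top (b := ∫⁻ _ : Ω, 1 ∂ν) (by simp) (lintegral_mono_ae ?_)
      filter_upwards [h, Measure.rnDeriv_lt_top ρ ν] with x hx hxt
      rw [phi, if_pos ((le_one_div_ofReal_iff (hw x)).2 ⟨hxt.ne, hx⟩), ENNReal.ofReal_le_one,
        abs_of_nonneg (by linarith)]
      have := mul_nonneg (hw x).le (ENNReal.toReal_nonneg (a := ρ.rnDeriv ν x))
      linarith
  · simp [hac]

theorem toReal_marginalPenalty [IsFiniteMeasure ρ] [IsFiniteMeasure ν]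
    (hw : ∀ x : Ω, 0 < bdryCost Ω x) (hwc : Continuous fun x : Ω => bdryCost Ω x)
    (h : marginalPenalty ρ ν ≠ ∞) :
    Integrable (fun x : Ω => 1 - bdryCost Ω x * (ρ.rnDeriv ν x).toReal) ν ∧
    (marginalPenalty ρ ν).toReal = ∫ x : Ω, (1 - bdryCost Ω x * (ρ.rnDeriv ν x).toReal) ∂ν := by
  obtain ⟨hac, hle⟩ := (marginalPenalty_ne_top_iff hw hwc).1 h
  have hm : Measurable fun x : Ω => 1 - bdryCost Ω x * (ρ.rnDeriv ν x).toReal :=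
    measurable_const.sub (hwc.measurable.mul (Measure.measurable_rnDeriv ρ ν).ennreal_toReal)
  have hnn : 0 ≤ᵐ[ν] fun x : Ω => 1 - bdryCost Ω x * (ρ.rnDeriv ν x).toReal := by
    filter_upwards [hle] with x hx
    simpa using hx
  constructor
  · refine Integrable.mono' (integrable_const (1 : ℝ)) hm.aestronglyMeasurable ?_
    filter_upwards [hnn] with x hx
    rw [Real.norm_eq_abs, abs_of_nonneg hx]
    have := mul_nonneg (hw x).le (ENNReal.toReal_nonneg (a := ρ.rnDeriv ν x))
    linarith
  · rw [integral_eq_lintegral_of_nonneg_ae hnn hm.aestronglyMeasurable, marginalPenalty,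
      if_pos hac]
    congr 1
    refine lintegral_congr_ae ?_
    filter_upwards [hle, hnn, Measure.rnDeriv_lt_top ρ ν] with x hx hx0 hxt
    rw [phi, if_pos ((le_one_div_ofReal_iff (hw x)).2 ⟨hxt.ne, hx⟩), abs_of_nonneg hx0]

/-- The pointwise slack in the Fenchel inequality between the marginal penalty and its dual. -/
noncomputable def marginalGap (ρ ν : Measure Ω) (f : Ω → ℝ) (x : Ω) : ℝ :=
  1 - bdryCost Ω x * (ρ.rnDeriv ν x).toReal + (ρ.rnDeriv ν x).toReal * f x
    - min 1 (f x / bdryCost Ω x)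

/-- With `t = w * s`, the right side is the convex combination of `1` and `s` with weights `1 - w *
u` and `w * u`, hence at least their minimum. -/
theorem min_one_div_le {w u t : ℝ} (hw : 0 < w) (hu : 0 ≤ u) (hwu : w * u ≤ 1) :
    min 1 (t / w) ≤ 1 - w * u + u * t := by
  obtain ⟨s, rfl⟩ : ∃ s, t = w * s := ⟨t / w, by field_simp⟩
  rw [mul_div_cancel_left₀ _ hw.ne']
  have h0 : 0 ≤ w * u := by positivity
  rcases le_total 1 s with h | h
  · rw [min_eq_left h]
    nlinarith
  · rw [min_eq_right h]
    nlinarith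

/-- Where `f` is negative, the constraint bounds the density by `1 / bdryCost`, so density times
`-f` is at most `|f / bdryCost|`, which is the integrable dual integrand there. -/
theorem integrable_negPart_of_marginalPenalty_ne_top [IsFiniteMeasure ρ] [IsFiniteMeasure ν]
    (hw : ∀ x : Ω, 0 < bdryCost Ω x) (hwc : Continuous fun x : Ω => bdryCost Ω x)
    (h : marginalPenalty ρ ν ≠ ∞) {f : Ω → ℝ} (hf : Measurable f)
    (hfi : Integrable (fun x : Ω => min 1 (f x / bdryCost Ω x)) ν) :
    Integrable (fun x => max (-f x) 0) ρ := by
  obtain ⟨hac, hle⟩ := (marginalPenalty_ne_top_iff hw hwc).1 h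
  rw [← integrable_rnDeriv_smul_iff hac]
  refine hfi.mono ?_ ?_
  · exact ((Measure.measurable_rnDeriv ρ ν).ennreal_toReal.smul
      (hf.neg.max measurable_const)).aestronglyMeasurable
  · filter_upwards [hle] with x hx
    have hu := ENNReal.toReal_nonneg (a := ρ.rnDeriv ν x)
    have hwx := hw x
    set u := (ρ.rnDeriv ν x).toReal
    rw [smul_eq_mul, norm_mul, Real.norm_of_nonneg hu, Real.norm_of_nonneg (le_max_right _ _)]
    rcases le_total 0 (f x) with h0 | h0
    · rw [max_eq_right (by linarith), mul_zero]
      exact norm_nonneg _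
    · have h1 : f x / bdryCost Ω x ≤ 0 := div_nonpos_of_nonpos_of_nonneg h0 hwx.le
      rw [max_eq_left (by linarith), min_eq_right (by linarith), Real.norm_of_nonpos h1,
        ← neg_div, le_div_iff₀ hwx]
      nlinarith

theorem marginalGap_nonneg [IsFiniteMeasure ρ] [IsFiniteMeasure ν]
    (hw : ∀ x : Ω, 0 < bdryCost Ω x) (hwc : Continuous fun x : Ω => bdryCost Ω x)
    (h : marginalPenalty ρ ν ≠ ∞) (f : Ω → ℝ) : 0 ≤ᵐ[ν] marginalGap ρ ν f := by
  filter_upwards [((marginalPenalty_ne_top_iff hw hwc).1 h).2] with x hx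
  exact sub_nonneg.2 (min_one_div_le (hw x) ENNReal.toReal_nonneg hx)

theorem toReal_marginalPenalty_add_integral [IsFiniteMeasure ρ] [IsFiniteMeasure ν]
    (hw : ∀ x : Ω, 0 < bdryCost Ω x) (hwc : Continuous fun x : Ω => bdryCost Ω x)
    (h : marginalPenalty ρ ν ≠ ∞) {f : Ω → ℝ}
    (hfi : Integrable (fun x : Ω => min 1 (f x / bdryCost Ω x)) ν) (hfρ : Integrable f ρ) :
    (marginalPenalty ρ ν).toReal + ∫ x, f x ∂ρ
      = ∫ x : Ω, min 1 (f x / bdryCost Ω x) ∂ν + ∫ x, marginalGap ρ ν f x ∂ν := by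
  have hac := ((marginalPenalty_ne_top_iff hw hwc).1 h).1
  obtain ⟨h1, h2⟩ := toReal_marginalPenalty hw hwc h
  have h3 := (integrable_rnDeriv_smul_iff hac).2 hfρ
  rw [h2, ← integral_rnDeriv_smul hac]
  simp only [smul_eq_mul] at h3 ⊢
  have h4 : Integrable (fun x : Ω => 1 - bdryCost Ω x * (ρ.rnDeriv ν x).toReal
      + (ρ.rnDeriv ν x).toReal * f x) ν := h1.add h3
  unfold marginalGap
  rw [integral_sub h4 hfi, integral_add h1 h3]
  ring

end Marginal

/-! ### The duality gap as a sum of nonnegative slacks. -/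

section DualityGap

variable {d : ℕ} {Ω : Set (E d)} {ε : ℝ} {α β : Measure Ω}

theorem continuous_gibbs (ε : ℝ) (f g : C(Ω, ℝ)) : Continuous (gibbs ε f g) := by
  have := continuous_cost (Ω := Ω)
  unfold gibbs
  fun_prop

theorem dualObj_eq_coe {f g : C(Ω, ℝ)} [IsFiniteMeasure (renorm α)] [IsFiniteMeasure (renorm β)]
    (hf : Integrable (fun x : Ω => min 1 (f x / bdryCost Ω x)) (renorm α))
    (hg : Integrable (fun x : Ω => min 1 (g x / bdryCost Ω x)) (renorm β))
    (hfg : Integrable (fun p => gibbs ε f g p / geomMass (renorm α) (renorm β))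
      ((renorm α).prod (renorm β))) :
    dualObj ε α β f g = ((∫ x : Ω, min 1 (f x / bdryCost Ω x) ∂renorm α
      + ∫ x : Ω, min 1 (g x / bdryCost Ω x) ∂renorm β
      - ε * (∫ p, gibbs ε f g p / geomMass (renorm α) (renorm β) ∂(renorm α).prod (renorm β)
        - 1 / harmMass (renorm α) (renorm β) * ((renorm α).prod (renorm β)).real univ) : ℝ) :
        EReal) := by
  rw [dualObj, extIntegral_of_integrable hf, extIntegral_of_integrable hg,
    extIntegral_of_integrable (h := fun p => gibbs ε f g p / geomMass (renorm α) (renorm β)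
      - 1 / harmMass (renorm α) (renorm β)) (hfg.sub (integrable_const _)),
    integral_sub hfg (integrable_const _), integral_const, smul_eq_mul, mul_comm (Measure.real _ _)]
  norm_cast

/-- Each term is bounded on the side where divergence would raise the objective, so a divergent term
can only send it to `⊥`. -/
theorem integrable_of_dualObj_ne_bot (hε : 0 < ε)
    (hwc : Continuous fun x : Ω => bdryCost Ω x)
    [IsFiniteMeasure (renorm α)] [IsFiniteMeasure (renorm β)]
    {f g : C(Ω, ℝ)} (h : dualObj ε α β f g ≠ ⊥) :
    Integrable (fun x : Ω => min 1 (f x / bdryCost Ω x)) (renorm α) ∧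
    Integrable (fun x : Ω => min 1 (g x / bdryCost Ω x)) (renorm β) ∧
    Integrable (fun p => gibbs ε f g p / geomMass (renorm α) (renorm β))
      ((renorm α).prod (renorm β)) := by
  have hm : ∀ f : C(Ω, ℝ), Measurable fun x : Ω => min 1 (f x / bdryCost Ω x) := fun f =>
    measurable_const.min (f.continuous.measurable.div hwc.measurable)
  have h1 := extIntegral_of_le (μ := renorm α) (hm f) (C := 1) fun x => min_le_left _ _
  have h2 := extIntegral_of_le (μ := renorm β) (hm g) (C := 1) fun x => min_le_left _ _
  have h3 := extIntegral_of_ge (μ := (renorm α).prod (renorm β))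
    (h := fun p => gibbs ε f g p / geomMass (renorm α) (renorm β)
      - 1 / harmMass (renorm α) (renorm β))
    (((continuous_gibbs ε f g).measurable.div_const _).sub_const _)
    (C := 0 - 1 / harmMass (renorm α) (renorm β)) fun p =>
      sub_le_sub_right (div_nonneg (Real.exp_pos _).le (Real.sqrt_nonneg _)) _
  refine ⟨h1.resolve_left fun h0 => h ?_, h2.resolve_left fun h0 => h ?_, ?_⟩
  · rw [dualObj, h0, EReal.bot_add, EReal.bot_sub]
  · rw [dualObj, h0, EReal.add_bot, EReal.bot_sub]
  · have h4 := h3.resolve_left fun h0 => h ?_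
    · exact (h4.add (integrable_const (1 / harmMass (renorm α) (renorm β)))).congr
        (ae_of_all _ fun x => by simp)
    · rw [dualObj, h0, EReal.coe_mul_top_of_pos hε, EReal.sub_top]

/-- The pointwise slack in the Fenchel inequality between the entropy of a plan and its dual. -/
noncomputable def planGap (ε m : ℝ) (f g : C(Ω, ℝ)) (π P : Measure (Ω × Ω)) (p : Ω × Ω) : ℝ :=
  (π.rnDeriv P p).toReal * (cost (p.1 : E d) p.2
    + ε * (Real.log (π.rnDeriv P p).toReal + (Real.log m - 1)) - (f p.1 + g p.2))
    + ε * (gibbs ε f g p / m)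

/-- For `p > 0` this is the strict inequality `log (q / p) < q / p - 1` multiplied by `p`. -/
theorem mul_log_sub_add_pos {p q : ℝ} (hp : 0 ≤ p) (hq : 0 < q) (hpq : p ≠ q) :
    0 < p * (Real.log p - 1 - Real.log q) + q := by
  rcases hp.eq_or_lt with rfl | hp
  · simpa using hq
  · have h := Real.log_lt_sub_one_of_pos (div_pos hq hp) fun h =>
      hpq ((div_eq_one_iff_eq hp.ne').1 h).symm
    rw [Real.log_div hq.ne' hp.ne', ← sub_pos] at h
    have h2 := mul_pos hp h
    have h3 : p * (q / p - 1 - (Real.log q - Real.log p))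
        = p * (Real.log p - 1 - Real.log q) + q := by
      field_simp
      ring
    rwa [h3] at h2

/-- The cost and the potentials are absorbed into the logarithm of the Gibbs kernel, leaving `ε`
times the relative entropy integrand of the density against the Gibbs density. -/
theorem planGap_eq (hε : 0 < ε) {m : ℝ} (hm : 0 < m) (f g : C(Ω, ℝ)) (π P : Measure (Ω × Ω))
    (p : Ω × Ω) : planGap ε m f g π P p = ε * ((π.rnDeriv P p).toReal *
      (Real.log (π.rnDeriv P p).toReal - 1 - Real.log (gibbs ε f g p / m))
        + gibbs ε f g p / m) := by
  rw [planGap, Real.log_div (by exact (Real.exp_pos _).ne') hm.ne']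
  conv_rhs => rw [gibbs, Real.log_exp]
  rw [gibbs]
  field_simp
  ring

theorem planGap_pos (hε : 0 < ε) {m : ℝ} (hm : 0 < m) {f g : C(Ω, ℝ)} {π P : Measure (Ω × Ω)}
    {p : Ω × Ω} (h : (π.rnDeriv P p).toReal ≠ gibbs ε f g p / m) :
    0 < planGap ε m f g π P p := by
  rw [planGap_eq hε hm]
  exact mul_pos hε (mul_log_sub_add_pos ENNReal.toReal_nonneg (div_pos (Real.exp_pos _) hm) h)

theorem planGap_eq_zero (hε : 0 < ε) {m : ℝ} (hm : 0 < m) {f g : C(Ω, ℝ)} {π P : Measure (Ω × Ω)}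
    {p : Ω × Ω} (h : (π.rnDeriv P p).toReal = gibbs ε f g p / m) :
    planGap ε m f g π P p = 0 := by
  rw [planGap_eq hε hm, h]
  ring

theorem planGap_nonneg (hε : 0 < ε) {m : ℝ} (hm : 0 < m) (f g : C(Ω, ℝ)) (π P : Measure (Ω × Ω)) :
    0 ≤ planGap ε m f g π P := fun p => by
  by_cases h : (π.rnDeriv P p).toReal = gibbs ε f g p / m
  · exact (planGap_eq_zero hε hm h).ge
  · exact (planGap_pos hε hm h).le

variable {π : Measure (Ω × Ω)}

theorem integrable_cost (hC : ∃ C, ∀ x y : Ω, cost (x : E d) y ≤ C) [IsFiniteMeasure π] :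
    Integrable (fun p : Ω × Ω => cost (p.1 : E d) p.2) π := by
  obtain ⟨C, hC⟩ := hC
  refine Integrable.mono' (integrable_const C) continuous_cost.aestronglyMeasurable
    (ae_of_all _ fun p => ?_)
  rw [Real.norm_of_nonneg (cost_nonneg _ _)]
  exact hC _ _

theorem primalObj_ne_top (hC : ∃ C, ∀ x y : Ω, cost (x : E d) y ≤ C) [IsFiniteMeasure π]
    (h1 : marginalPenalty (π.map Prod.fst) (renorm α) ≠ ∞)
    (h2 : marginalPenalty (π.map Prod.snd) (renorm β) ≠ ∞)
    (h3 : entropicReg π (renorm α) (renorm β) ≠ ∞) : primalObj ε α β π ≠ ∞ := by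
  have h0 := (integrable_cost (π := π) hC).lintegral_lt_top.ne
  simp only [primalObj, Ne, ENNReal.add_eq_top, not_or]
  exact ⟨⟨⟨h0, h1⟩, h2⟩, ENNReal.mul_ne_top ENNReal.ofReal_ne_top h3⟩

theorem ne_top_of_primalObj_ne_top (hε : 0 < ε) (h : primalObj ε α β π ≠ ∞) :
    ∫⁻ p : Ω × Ω, ENNReal.ofReal (cost (p.1 : E d) p.2) ∂π ≠ ∞ ∧
    marginalPenalty (π.map Prod.fst) (renorm α) ≠ ∞ ∧
    marginalPenalty (π.map Prod.snd) (renorm β) ≠ ∞ ∧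
    entropicReg π (renorm α) (renorm β) ≠ ∞ := by
  simp only [primalObj, Ne, ENNReal.add_eq_top, not_or] at h
  obtain ⟨⟨⟨h0, h1⟩, h2⟩, h3⟩ := h
  refine ⟨h0, h1, h2, fun h4 => h3 ?_⟩
  rw [h4, ENNReal.mul_top]
  simpa using hε

theorem toReal_primalObj (hε : 0 < ε) (h : primalObj ε α β π ≠ ∞) :
    (primalObj ε α β π).toReal = ∫ p : Ω × Ω, cost (p.1 : E d) p.2 ∂π
      + (marginalPenalty (π.map Prod.fst) (renorm α)).toReal
      + (marginalPenalty (π.map Prod.snd) (renorm β)).toReal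
      + ε * (entropicReg π (renorm α) (renorm β)).toReal := by
  obtain ⟨h0, h1, h2, h3⟩ := ne_top_of_primalObj_ne_top hε h
  have h4 := ENNReal.mul_ne_top (ENNReal.ofReal_ne_top (r := ε)) h3
  rw [primalObj, ENNReal.toReal_add (by simp [h0, h1, h2]) h4, ENNReal.toReal_add (by simp [h0, h1])
    h2, ENNReal.toReal_add h0 h1, ENNReal.toReal_mul, ENNReal.toReal_ofReal hε.le,
    integral_eq_lintegral_of_nonneg_ae (ae_of_all _ fun p => cost_nonneg _ _)
    continuous_cost.aestronglyMeasurable]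

/-- The difference of the primal and dual objectives is the sum of the three integrated slacks. -/
theorem toReal_primalObj_eq_add (hε : 0 < ε) (hw : ∀ x : Ω, 0 < bdryCost Ω x)
    (hwc : Continuous fun x : Ω => bdryCost Ω x) (hC : ∃ C, ∀ x y : Ω, cost (x : E d) y ≤ C)
    [IsFiniteMeasure (renorm α)] [IsFiniteMeasure (renorm β)]
    (hα : renorm α ≠ 0) (hβ : renorm β ≠ 0) [SigmaFinite π]
    (hπ : primalObj ε α β π ≠ ∞) {f g : C(Ω, ℝ)} (hfg : dualObj ε α β f g ≠ ⊥) :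
    ∃ D : ℝ, dualObj ε α β f g = D ∧
      0 ≤ᵐ[renorm α] marginalGap (π.map Prod.fst) (renorm α) f ∧
      0 ≤ᵐ[renorm β] marginalGap (π.map Prod.snd) (renorm β) g ∧
      Integrable (planGap ε (geomMass (renorm α) (renorm β)) f g π
        ((renorm α).prod (renorm β))) ((renorm α).prod (renorm β)) ∧
      (primalObj ε α β π).toReal = D
        + ∫ x, marginalGap (π.map Prod.fst) (renorm α) f x ∂renorm α
        + ∫ x, marginalGap (π.map Prod.snd) (renorm β) g x ∂renorm β
        + ∫ p, planGap ε (geomMass (renorm α) (renorm β)) f g π ((renorm α).prod (renorm β)) p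
          ∂(renorm α).prod (renorm β) := by
  obtain ⟨-, hp1, hp2, hp3⟩ := ne_top_of_primalObj_ne_top hε hπ
  obtain ⟨hf, hg, hG⟩ := integrable_of_dualObj_ne_bot hε hwc hfg
  obtain ⟨hfin, hac, hllr⟩ := (entropicReg_ne_top_iff hα hβ).1 hp3
  have hm := geomMass_pos hα hβ
  have hcost := integrable_cost (π := π) hC
  have hnf := (integrable_negPart_of_marginalPenalty_ne_top hw hwc hp1 f.continuous.measurable
    hf).comp_measurable measurable_fst
  have hng := (integrable_negPart_of_marginalPenalty_ne_top hw hwc hp2 g.continuous.measurable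
    hg).comp_measurable measurable_snd
  set P := (renorm α).prod (renorm β) with hP
  set m := geomMass (renorm α) (renorm β)
  have hL : Integrable (fun p => llr π P p + (Real.log m - 1)) π := hllr.add (integrable_const _)
  have hK : Integrable (fun p : Ω × Ω => cost (p.1 : E d) p.2
      + ε * (llr π P p + (Real.log m - 1))) π :=
    hcost.add (hL.const_mul ε)
  have hKP := (integrable_rnDeriv_smul_iff hac).2 hK
  have hNP := (integrable_rnDeriv_smul_iff hac).2 (hnf.add hng)
  have hpm : Measurable fun p => (π.rnDeriv P p).toReal :=
    (Measure.measurable_rnDeriv π P).ennreal_toReal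
  have hSm : Measurable fun p : Ω × Ω => f p.1 + g p.2 := by
    have := f.continuous.measurable
    have := g.continuous.measurable
    fun_prop
  -- From above, nonnegativity of `planGap` bounds density times `f + g` by the cost-entropy term
  -- plus the Gibbs term; from below, the negative parts do.
  have hS : Integrable (fun p : Ω × Ω => f p.1 + g p.2) π := by
    rw [← integrable_rnDeriv_smul_iff hac]
    refine Integrable.mono' ((hKP.abs.add (hG.const_mul ε)).add hNP)
      (hpm.smul hSm).aestronglyMeasurable (ae_of_all _ fun p => ?_)
    have h1 := planGap_nonneg hε hm f g π P p
    have h2 : 0 ≤ (π.rnDeriv P p).toReal := ENNReal.toReal_nonneg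
    have h3 : 0 ≤ ε * (gibbs ε f g p / m) :=
      mul_nonneg hε.le (div_nonneg (Real.exp_pos _).le hm.le)
    simp only [planGap, Pi.zero_apply] at h1
    simp only [Pi.add_apply, Function.comp, smul_eq_mul, llr_def]
    set u := (π.rnDeriv P p).toReal
    have h4 := le_abs_self (u * (cost (p.1 : E d) p.2
      + ε * (Real.log u + (Real.log m - 1))))
    have h5 := abs_nonneg (u * (cost (p.1 : E d) p.2
      + ε * (Real.log u + (Real.log m - 1))))
    have h6 : 0 ≤ u * (max (-f p.1) 0 + max (-g p.2) 0) := by positivity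
    have h7 : u * -(f p.1 + g p.2) ≤ u * (max (-f p.1) 0 + max (-g p.2) 0) :=
      mul_le_mul_of_nonneg_left (by
        have := le_max_left (-f p.1) 0
        have := le_max_left (-g p.2) 0
        linarith) h2
    rw [Real.norm_eq_abs, abs_le]
    constructor <;> linarith
  -- The potentials separate because `f` is at most `f + g` plus the negative part of `g`.
  have hfi : Integrable (fun p : Ω × Ω => f p.1) π := by
    refine Integrable.mono' ((hS.add (hnf.add hng)).add hnf)
      (f.continuous.comp continuous_fst).aestronglyMeasurable (ae_of_all _ fun p => ?_)
    simp only [Pi.add_apply, Function.comp]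
    have h1 := le_max_left (-f p.1) 0
    have h2 := le_max_left (-g p.2) 0
    have h3 := le_max_right (-f p.1) 0
    have h4 := le_max_right (-g p.2) 0
    rw [Real.norm_eq_abs, abs_le]
    rcases le_total 0 (g p.2) with h | h
    · constructor <;> linarith
    · constructor <;> linarith
  have hgi : Integrable (fun p : Ω × Ω => g p.2) π :=
    (hS.sub hfi).congr (ae_of_all _ fun p => by simp)
  have hfi' : Integrable f (π.map Prod.fst) :=
    (integrable_map_measure f.continuous.aestronglyMeasurable measurable_fst.aemeasurable).2 hfi
  have hgi' : Integrable g (π.map Prod.snd) :=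
    (integrable_map_measure g.continuous.aestronglyMeasurable measurable_snd.aemeasurable).2 hgi
  have e1 := toReal_marginalPenalty_add_integral hw hwc hp1 hf hfi'
  have e2 := toReal_marginalPenalty_add_integral hw hwc hp2 hg hgi'
  rw [integral_map measurable_fst.aemeasurable f.continuous.aestronglyMeasurable] at e1
  rw [integral_map measurable_snd.aemeasurable g.continuous.aestronglyMeasurable] at e2
  have hQ : Integrable (fun p : Ω × Ω => cost (p.1 : E d) p.2
      + ε * (llr π P p + (Real.log m - 1)) - (f p.1 + g p.2)) π := hK.sub hS
  have hQP := (integrable_rnDeriv_smul_iff hac).2 hQ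
  have hgap : Integrable (planGap ε m f g π P) P := hQP.add (hG.const_mul ε)
  have e3 : ∫ p, planGap ε m f g π P p ∂P
      = ∫ p : Ω × Ω, cost (p.1 : E d) p.2 ∂π
        + ε * (∫ p, llr π P p ∂π + (Real.log m - 1) * π.real univ)
        - (∫ p : Ω × Ω, f p.1 ∂π + ∫ p : Ω × Ω, g p.2 ∂π)
        + ε * ∫ p, gibbs ε f g p / m ∂P := by
    calc ∫ p, planGap ε m f g π P p ∂P
        = ∫ p, (π.rnDeriv P p).toReal • (cost (p.1 : E d) p.2
          + ε * (llr π P p + (Real.log m - 1)) - (f p.1 + g p.2)) ∂P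
          + ∫ p, ε * (gibbs ε f g p / m) ∂P := integral_add hQP (hG.const_mul ε)
      _ = _ := by
        rw [integral_rnDeriv_smul hac, integral_sub hK hS, integral_add hfi hgi,
          integral_add hcost (hL.const_mul ε), integral_const_mul, integral_const_mul,
          integral_add hllr (integrable_const _), integral_const, smul_eq_mul,
          mul_comm (π.real univ)]
  refine ⟨_, dualObj_eq_coe hf hg hG, marginalGap_nonneg hw hwc hp1 f,
    marginalGap_nonneg hw hwc hp2 g, hgap, ?_⟩
  rw [toReal_primalObj hε hπ, toReal_entropicReg hα hβ hac hllr, e3]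
  -- The integrals of the potentials against the plan cancel between the marginal identities and the
  -- entropy identity.
  linear_combination e1 + e2

end DualityGap

/-! ### The Sinkhorn map and its fixed point. -/

section Sinkhorn

variable {d : ℕ} {Ω : Set (E d)} {ε m M B : ℝ} {ν : Measure Ω} {g g' : Ω → ℝ}

/-- The integral of the Gibbs kernel with potential `g` against `ν`. -/
noncomputable def gibbsIntegral (ε m : ℝ) (ν : Measure Ω) (g : Ω → ℝ) (x : Ω) : ℝ :=
  ∫ y : Ω, Real.exp ((g y - cost (x : E d) y) / ε) / m ∂ν

/-- The potential that maximizes the dual objective when the other potential is `g`. -/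
noncomputable def sinkhorn (ε m : ℝ) (ν : Measure Ω) (g : Ω → ℝ) (x : Ω) : ℝ :=
  min (bdryCost Ω x) (-ε * Real.log (bdryCost Ω x * gibbsIntegral ε m ν g x))

theorem measurable_gibbs_section (hg : Measurable g) (x : Ω) :
    Measurable fun y : Ω => Real.exp ((g y - cost (x : E d) y) / ε) / m := by
  have : Measurable fun y : Ω => cost (x : E d) y := by
    unfold cost
    fun_prop
  fun_prop

theorem norm_gibbs_section_le (hε : 0 < ε) (hm : 0 < m) {t : ℝ} (ht : t ≤ M) (x y : E d) :
    ‖Real.exp ((t - cost x y) / ε) / m‖ ≤ Real.exp (M / ε) / m := by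
  rw [Real.norm_of_nonneg (by positivity)]
  have := cost_nonneg x y
  gcongr
  linarith

variable [IsFiniteMeasure ν]

theorem integrable_gibbs_section (hε : 0 < ε) (hm : 0 < m) (hg : Measurable g)
    (hgM : ∀ y, g y ≤ M) (x : Ω) :
    Integrable (fun y : Ω => Real.exp ((g y - cost (x : E d) y) / ε) / m) ν :=
  Integrable.mono' (integrable_const _) (measurable_gibbs_section hg x).aestronglyMeasurable
    (ae_of_all _ fun y => norm_gibbs_section_le hε hm (hgM y) _ _)

theorem gibbsIntegral_pos (hε : 0 < ε) (hm : 0 < m) (hν : ν ≠ 0) (hg : Measurable g)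
    (hgM : ∀ y, g y ≤ M) (x : Ω) : 0 < gibbsIntegral ε m ν g x := by
  rw [gibbsIntegral, integral_pos_iff_support_of_nonneg (fun y => by positivity)
    (integrable_gibbs_section hε hm hg hgM x)]
  have h : (Function.support fun y : Ω => Real.exp ((g y - cost (x : E d) y) / ε) / m) = univ :=
    eq_univ_of_forall fun y => (div_pos (Real.exp_pos _) hm).ne'
  rw [h]
  exact pos_iff_ne_zero.2 (by simpa using hν)

theorem gibbsIntegral_mono (hε : 0 < ε) (hm : 0 < m) (hg : Measurable g) (hg' : Measurable g')
    (hgM : ∀ y, g' y ≤ M) (hgg : ∀ y, g y ≤ g' y) (x : Ω) :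
    gibbsIntegral ε m ν g x ≤ gibbsIntegral ε m ν g' x := by
  refine integral_mono
    (integrable_gibbs_section hε hm hg (fun y => (hgg y).trans (hgM y)) x)
    (integrable_gibbs_section hε hm hg' hgM x) fun y => ?_
  have := hgg y
  dsimp only
  gcongr

theorem gibbsIntegral_le (hε : 0 < ε) (hm : 0 < m) (hgM : ∀ y, g y ≤ M) (x : Ω) :
    gibbsIntegral ε m ν g x ≤ Real.exp (M / ε) / m * ν.real univ :=
  (le_abs_self _).trans (norm_integral_le_of_norm_le_const
    (ae_of_all _ fun y => norm_gibbs_section_le hε hm (hgM y) _ _))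

theorem continuous_gibbsIntegral (hε : 0 < ε) (hm : 0 < m) (hg : Measurable g)
    (hgM : ∀ y, g y ≤ M) : Continuous (gibbsIntegral ε m ν g) := by
  refine continuous_of_dominated (bound := fun _ => Real.exp (M / ε) / m)
    (fun x => (measurable_gibbs_section hg x).aestronglyMeasurable)
    (fun x => ae_of_all _ fun y => norm_gibbs_section_le hε hm (hgM y) _ _)
    (integrable_const _) (ae_of_all _ fun y => ?_)
  unfold cost
  fun_prop

theorem tendsto_gibbsIntegral (hε : 0 < ε) (hm : 0 < m) {F : ℕ → Ω → ℝ}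
    (hF : ∀ n, Measurable (F n)) (hFM : ∀ n y, F n y ≤ M)
    (hlim : ∀ y, Filter.Tendsto (fun n => F n y) Filter.atTop (nhds (g y))) (x : Ω) :
    Filter.Tendsto (fun n => gibbsIntegral ε m ν (F n) x) Filter.atTop
      (nhds (gibbsIntegral ε m ν g x)) := by
  refine tendsto_integral_of_dominated_convergence (fun _ => Real.exp (M / ε) / m)
    (fun n => (measurable_gibbs_section (hF n) x).aestronglyMeasurable) (integrable_const _)
    (fun n => ae_of_all _ fun y => norm_gibbs_section_le hε hm (hFM n y) _ _)
    (ae_of_all _ fun y => ?_)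
  exact ((Real.continuous_exp.tendsto _).comp (((hlim y).sub_const _).div_const _)).div_const _

/-- The bound depends on `g` only through its upper bound `M`, so it is uniform along the iteration.
-/
theorem neg_abs_le_sinkhorn (hε : 0 < ε) (hm : 0 < m) (hν : ν ≠ 0)
    (hw : ∀ x : Ω, 0 < bdryCost Ω x) (hwM : ∀ x : Ω, bdryCost Ω x ≤ M) (hg : Measurable g)
    (hgM : ∀ y, g y ≤ M) (x : Ω) :
    -|ε * Real.log (M * (Real.exp (M / ε) / m * ν.real univ))| ≤ sinkhorn ε m ν g x := by
  have h1 := gibbsIntegral_pos (x := x) hε hm hν hg hgM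
  have h2 := gibbsIntegral_le (ν := ν) (x := x) hε hm hgM
  have h3 := hw x
  refine le_min ((neg_nonpos.2 (abs_nonneg _)).trans h3.le) ?_
  rw [neg_mul]
  refine neg_le_neg (le_trans ?_ (le_abs_self _))
  refine mul_le_mul_of_nonneg_left (Real.log_le_log (mul_pos h3 h1) ?_) hε.le
  exact mul_le_mul (hwM x) h2 h1.le (h3.le.trans (hwM x))

theorem sinkhorn_antitone (hε : 0 < ε) (hm : 0 < m) (hν : ν ≠ 0)
    (hw : ∀ x : Ω, 0 < bdryCost Ω x) (hg : Measurable g) (hg' : Measurable g')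
    (hgM : ∀ y, g' y ≤ M) (hgg : ∀ y, g y ≤ g' y) (x : Ω) :
    sinkhorn ε m ν g' x ≤ sinkhorn ε m ν g x := by
  have h1 := gibbsIntegral_pos hε hm hν hg (fun y => (hgg y).trans (hgM y)) x
  have h2 := gibbsIntegral_mono (ν := ν) hε hm hg hg' hgM hgg x
  have h3 := hw x
  refine min_le_min_left _ ?_
  rw [neg_mul, neg_mul]
  gcongr

theorem continuous_sinkhorn (hε : 0 < ε) (hm : 0 < m) (hν : ν ≠ 0)
    (hw : ∀ x : Ω, 0 < bdryCost Ω x) (hwc : Continuous fun x : Ω => bdryCost Ω x)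
    (hg : Measurable g) (hgM : ∀ y, g y ≤ M) : Continuous (sinkhorn ε m ν g) :=
  hwc.min (continuous_const.mul ((hwc.mul (continuous_gibbsIntegral hε hm hg hgM)).log
    fun x => (mul_pos (hw x) (gibbsIntegral_pos hε hm hν hg hgM x)).ne'))

theorem tendsto_sinkhorn (hε : 0 < ε) (hm : 0 < m) (hν : ν ≠ 0)
    (hw : ∀ x : Ω, 0 < bdryCost Ω x) {F : ℕ → Ω → ℝ}
    (hF : ∀ n, Measurable (F n)) (hFM : ∀ n y, F n y ≤ M)
    (hlim : ∀ y, Filter.Tendsto (fun n => F n y) Filter.atTop (nhds (g y))) (x : Ω) :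
    Filter.Tendsto (fun n => sinkhorn ε m ν (F n) x) Filter.atTop (nhds (sinkhorn ε m ν g x)) := by
  have hg : Measurable g := measurable_of_tendsto_metrizable hF (tendsto_pi_nhds.2 hlim)
  have hgM : ∀ y, g y ≤ M := fun y => le_of_tendsto' (hlim y) fun n => hFM n y
  exact tendsto_const_nhds.min (((Filter.Tendsto.const_mul _
    (tendsto_gibbsIntegral hε hm hF hFM hlim x)).log
    (mul_pos (hw x) (gibbsIntegral_pos hε hm hν hg hgM x)).ne').const_mul _)

/-- The two dual optimality conditions have a simultaneous bounded continuous solution. -/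
theorem exists_sinkhorn_fixedPoint {μ : Measure Ω} [IsFiniteMeasure μ] (hε : 0 < ε) (hm : 0 < m)
    (hμ : μ ≠ 0) (hν : ν ≠ 0) (hw : ∀ x : Ω, 0 < bdryCost Ω x)
    (hwc : Continuous fun x : Ω => bdryCost Ω x) (hwM : ∀ x : Ω, bdryCost Ω x ≤ M) :
    ∃ (f g : C(Ω, ℝ)) (B : ℝ), (∀ x, |f x| ≤ B) ∧ (∀ x, |g x| ≤ B) ∧
      (∀ x, f x = sinkhorn ε m ν g x) ∧ ∀ x, g x = sinkhorn ε m μ f x := by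
  have hTM : ∀ (ρ : Measure Ω) (g : Ω → ℝ) x, sinkhorn ε m ρ g x ≤ M := fun ρ g x =>
    (min_le_left _ _).trans (hwM x)
  -- The constant `M` bounds every value of `sinkhorn` from above, so the first iterate lies below
  -- the start and monotonicity propagates this.
  let F : ℕ → Ω → ℝ := fun n => (fun f => sinkhorn ε m ν (sinkhorn ε m μ f))^[n] fun _ => M
  have hF1 : ∀ n, F (n + 1) = sinkhorn ε m ν (sinkhorn ε m μ (F n)) := fun n =>
    Function.iterate_succ_apply' _ _ _
  have hFc : ∀ n, Continuous (F n) ∧ ∀ x, F n x ≤ M := by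
    intro n
    induction n with
    | zero => exact ⟨continuous_const, fun x => le_rfl⟩
    | succ n ih =>
      rw [hF1]
      exact ⟨continuous_sinkhorn hε hm hν hw hwc (continuous_sinkhorn hε hm hμ hw hwc
        ih.1.measurable ih.2).measurable (hTM _ _), hTM _ _⟩
  have hGc : ∀ n, Continuous (sinkhorn ε m μ (F n)) := fun n =>
    continuous_sinkhorn hε hm hμ hw hwc (hFc n).1.measurable (hFc n).2
  have hanti : ∀ n x, F (n + 1) x ≤ F n x := by
    intro n
    induction n with
    | zero => exact (hFc 1).2
    | succ n ih =>
      intro x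
      rw [congrFun (hF1 (n + 1)) x]
      refine le_of_le_of_eq ?_ (congrFun (hF1 n) x).symm
      exact sinkhorn_antitone hε hm hν hw (hGc n).measurable (hGc (n + 1)).measurable (hTM _ _)
        (sinkhorn_antitone hε hm hμ hw (hFc (n + 1)).1.measurable (hFc n).1.measurable
          (hFc n).2 ih) x
  set Bν := |ε * Real.log (M * (Real.exp (M / ε) / m * ν.real univ))|
  set Bμ := |ε * Real.log (M * (Real.exp (M / ε) / m * μ.real univ))|
  -- The index is shifted because the lower bound holds for values of `sinkhorn`, and the initial
  -- constant is not one by construction.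
  have hFB : ∀ n x, -Bν ≤ F (n + 1) x := fun n x => by
    rw [hF1]
    exact neg_abs_le_sinkhorn hε hm hν hw hwM (hGc n).measurable (hTM _ _) x
  have hlim : ∀ x, ∃ l, Filter.Tendsto (fun n => F n x) Filter.atTop (nhds l) := fun x => by
    have hbdd : BddBelow (range fun n => F (n + 1) x) :=
      ⟨-Bν, by rintro _ ⟨n, rfl⟩; exact hFB n x⟩
    exact ⟨_, (Filter.tendsto_add_atTop_iff_nat 1).1
      (tendsto_atTop_ciInf (antitone_nat_of_succ_le fun n => hanti (n + 1) x) hbdd)⟩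
  choose f hf using hlim
  have hfm : Measurable f :=
    measurable_of_tendsto_metrizable (fun n => (hFc n).1.measurable) (tendsto_pi_nhds.2 hf)
  have hfM : ∀ x, f x ≤ M := fun x => le_of_tendsto' (hf x) fun n => (hFc n).2 x
  have hg := tendsto_sinkhorn hε hm hμ hw (fun n => (hFc n).1.measurable) (fun n => (hFc n).2) hf
  have hgc := continuous_sinkhorn hε hm hμ hw hwc hfm hfM
  have hfix : f = sinkhorn ε m ν (sinkhorn ε m μ f) := by
    funext x
    refine tendsto_nhds_unique ((Filter.tendsto_add_atTop_iff_nat 1).2 (hf x)) ?_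
    simp_rw [hF1]
    exact tendsto_sinkhorn hε hm hν hw (fun n => (hGc n).measurable) (fun n => hTM _ _) hg x
  -- The pointwise limit is a priori only measurable; continuity returns because `sinkhorn` smooths
  -- measurable potentials that are bounded above.
  have hfc : Continuous f := by
    rw [hfix]
    exact continuous_sinkhorn hε hm hν hw hwc hgc.measurable (hTM _ _)
  refine ⟨⟨f, hfc⟩, ⟨_, hgc⟩, max |M| (max Bν Bμ), fun x => ?_, fun x => ?_,
    fun x => congrFun hfix x, fun x => rfl⟩
  · have h1 : -Bν ≤ f x := by
      rw [hfix]
      exact neg_abs_le_sinkhorn hε hm hν hw hwM hgc.measurable (hTM _ _) x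
    have h2 := le_max_left |M| (max Bν Bμ)
    have h3 := (le_max_left Bν Bμ).trans (le_max_right |M| _)
    exact abs_le.2 ⟨(neg_le_neg h3).trans h1, (hfM x).trans ((le_abs_self M).trans h2)⟩
  · have h1 := neg_abs_le_sinkhorn hε hm hμ hw hwM hfm hfM x
    have h2 := le_max_left |M| (max Bν Bμ)
    have h3 := (le_max_right Bν Bμ).trans (le_max_right |M| _)
    exact abs_le.2 ⟨(neg_le_neg h3).trans h1,
      (hTM μ f x).trans ((le_abs_self M).trans h2)⟩

end Sinkhorn

/-! ### Optimality of the Gibbs plan, strong duality and identification of the plan. -/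

section Optimality

theorem map_fst_withDensity_prod {X Y : Type*} [MeasurableSpace X] [MeasurableSpace Y]
    {μ : Measure X} {ν : Measure Y} [SFinite μ] [SFinite ν] {F : X × Y → ℝ≥0∞}
    (hF : Measurable F) : ((μ.prod ν).withDensity F).map Prod.fst
      = μ.withDensity fun x => ∫⁻ y, F (x, y) ∂ν := by
  ext s hs
  rw [Measure.map_apply measurable_fst hs, withDensity_apply _ (measurable_fst hs),
    withDensity_apply _ hs, ← prod_univ, ← Measure.prod_restrict, Measure.restrict_univ,
    lintegral_prod _ hF.aemeasurable]

theorem map_snd_withDensity_prod {X Y : Type*} [MeasurableSpace X] [MeasurableSpace Y]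
    {μ : Measure X} {ν : Measure Y} [SFinite μ] [SFinite ν] {F : X × Y → ℝ≥0∞}
    (hF : Measurable F) : ((μ.prod ν).withDensity F).map Prod.snd
      = ν.withDensity fun y => ∫⁻ x, F (x, y) ∂μ := by
  ext s hs
  rw [Measure.map_apply measurable_snd hs, withDensity_apply _ (measurable_snd hs),
    withDensity_apply _ hs, ← univ_prod, ← Measure.prod_restrict, Measure.restrict_univ,
    lintegral_prod_symm _ hF.aemeasurable]

variable {d : ℕ} {Ω : Set (E d)} {ε m M B : ℝ}

/-- Complementary slackness, with `w` the boundary cost and `K` the kernel integral: either the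
potential equals `w` and its terms cancel, or it is the logarithmic branch and the marginal
constraint is saturated. -/
theorem sinkhorn_marginal {w K : ℝ} (hε : 0 < ε) (hw : 0 < w) (hK : 0 < K) :
    w * (Real.exp (min w (-ε * Real.log (w * K)) / ε) * K) ≤ 1 ∧
    1 - w * (Real.exp (min w (-ε * Real.log (w * K)) / ε) * K)
      + Real.exp (min w (-ε * Real.log (w * K)) / ε) * K * min w (-ε * Real.log (w * K))
      - min 1 (min w (-ε * Real.log (w * K)) / w) = 0 := by
  have hwK : 0 < w * K := mul_pos hw hK
  have h0 : w * (Real.exp (-ε * Real.log (w * K) / ε) * K) = 1 := by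
    rw [neg_mul, neg_div, mul_div_cancel_left₀ _ hε.ne', Real.exp_neg, Real.exp_log hwK]
    field_simp
  rcases le_total w (-ε * Real.log (w * K)) with h | h
  · rw [min_eq_left h, div_self hw.ne', min_self]
    refine ⟨h0 ▸ ?_, by ring⟩
    gcongr
  · rw [min_eq_right h]
    refine ⟨h0.le, ?_⟩
    rw [min_eq_right ((div_le_one hw).2 h), h0, sub_self, zero_add, sub_eq_zero,
      eq_div_iff hw.ne']
    linear_combination (-ε * Real.log (w * K)) * h0

theorem lintegral_gibbs_section {ν : Measure Ω} [IsFiniteMeasure ν] (hε : 0 < ε) (hm : 0 < m)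
    {g : Ω → ℝ} (hg : Measurable g) (hgM : ∀ y, g y ≤ M) (t : ℝ) (x : Ω) :
    ∫⁻ y : Ω, ENNReal.ofReal (Real.exp ((t + g y - cost (x : E d) y) / ε) / m) ∂ν
      = ENNReal.ofReal (Real.exp (t / ε) * gibbsIntegral ε m ν g x) := by
  rw [gibbsIntegral, ← integral_const_mul, ofReal_integral_eq_lintegral_ofReal
    ((integrable_gibbs_section hε hm hg hgM x).const_mul _) (ae_of_all _ fun y => by positivity)]
  refine lintegral_congr fun y => ?_
  rw [← mul_div_assoc, ← Real.exp_add]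
  congr 3
  ring

theorem marginal_optimal {ρ ν μ : Measure Ω} [IsFiniteMeasure ρ] [IsFiniteMeasure μ]
    [IsFiniteMeasure ν] (hε : 0 < ε) (hm : 0 < m) (hν : ν ≠ 0)
    (hw : ∀ x : Ω, 0 < bdryCost Ω x) (hwc : Continuous fun x : Ω => bdryCost Ω x)
    {f g : Ω → ℝ} (hfm : Measurable f) (hg : Measurable g) (hgM : ∀ y, g y ≤ M)
    (hf : ∀ x, f x = sinkhorn ε m ν g x)
    (hρ : ρ = μ.withDensity fun x =>
      ENNReal.ofReal (Real.exp (f x / ε) * gibbsIntegral ε m ν g x)) :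
    marginalPenalty ρ μ ≠ ∞ ∧ marginalGap ρ μ f =ᵐ[μ] 0 := by
  have hmeas : Measurable fun x =>
      ENNReal.ofReal (Real.exp (f x / ε) * gibbsIntegral ε m ν g x) := by
    have := (continuous_gibbsIntegral (ν := ν) hε hm hg hgM).measurable
    fun_prop
  have hd : ∀ᵐ x ∂μ, (ρ.rnDeriv μ x).toReal = Real.exp (f x / ε) * gibbsIntegral ε m ν g x := by
    rw [hρ]
    filter_upwards [Measure.rnDeriv_withDensity μ hmeas] with x hx
    have := gibbsIntegral_pos hε hm hν hg hgM x
    rw [hx, ENNReal.toReal_ofReal (by positivity)]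
  have key := fun x => sinkhorn_marginal hε (hw x) (gibbsIntegral_pos hε hm hν hg hgM x)
  constructor
  · rw [marginalPenalty_ne_top_iff hw hwc]
    refine ⟨hρ ▸ withDensity_absolutelyContinuous _ _, ?_⟩
    filter_upwards [hd] with x hx
    rw [hx, hf]
    exact (key x).1
  · filter_upwards [hd] with x hx
    rw [marginalGap, hx, hf]
    exact (key x).2

variable {α β : Measure Ω}

theorem gibbs_le (hε : 0 < ε) {f g : C(Ω, ℝ)} (hf : ∀ x, |f x| ≤ B) (hg : ∀ x, |g x| ≤ B)
    (p : Ω × Ω) : gibbs ε f g p ≤ Real.exp (2 * B / ε) := by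
  rw [gibbs]
  have h1 := (le_abs_self _).trans (hf p.1)
  have h2 := (le_abs_self _).trans (hg p.2)
  have h3 := cost_nonneg (p.1 : E d) p.2
  gcongr
  linarith

theorem isFiniteMeasure_gibbsPlan (hε : 0 < ε) [IsFiniteMeasure (renorm α)]
    [IsFiniteMeasure (renorm β)] {f g : C(Ω, ℝ)} (hf : ∀ x, |f x| ≤ B) (hg : ∀ x, |g x| ≤ B) :
    IsFiniteMeasure (gibbsPlan ε α β f g) := by
  refine isFiniteMeasure_withDensity (lintegral_ofReal_ne_top_of_le
    (C := Real.exp (2 * B / ε) / geomMass (renorm α) (renorm β)) fun p => ?_)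
  exact div_le_div_of_nonneg_right (gibbs_le hε hf hg p) (Real.sqrt_nonneg _)

theorem measurable_gibbsPlan_density (ε m : ℝ) (f g : C(Ω, ℝ)) :
    Measurable fun p => ENNReal.ofReal (gibbs ε f g p / m) :=
  ((continuous_gibbs ε f g).measurable.div_const _).ennreal_ofReal

theorem rnDeriv_gibbsPlan [IsFiniteMeasure (renorm α)] [IsFiniteMeasure (renorm β)]
    (f g : C(Ω, ℝ)) :
    ∀ᵐ p ∂(renorm α).prod (renorm β),
      ((gibbsPlan ε α β f g).rnDeriv ((renorm α).prod (renorm β)) p).toReal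
        = gibbs ε f g p / geomMass (renorm α) (renorm β) := by
  filter_upwards [Measure.rnDeriv_withDensity ((renorm α).prod (renorm β))
    (measurable_gibbsPlan_density ε (geomMass (renorm α) (renorm β)) f g)] with p hp
  rw [gibbsPlan, hp, ENNReal.toReal_ofReal]
  exact div_nonneg (Real.exp_pos _).le (Real.sqrt_nonneg _)

/-- Bounded potentials and bounded cost make the log-density bounded. -/
theorem entropicReg_gibbsPlan_ne_top (hε : 0 < ε) (hC : ∃ C, ∀ x y : Ω, cost (x : E d) y ≤ C)
    [IsFiniteMeasure (renorm α)] [IsFiniteMeasure (renorm β)]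
    (hα : renorm α ≠ 0) (hβ : renorm β ≠ 0) {f g : C(Ω, ℝ)} (hf : ∀ x, |f x| ≤ B)
    (hg : ∀ x, |g x| ≤ B) :
    entropicReg (gibbsPlan ε α β f g) (renorm α) (renorm β) ≠ ∞ := by
  obtain ⟨C, hC⟩ := hC
  have hfin : IsFiniteMeasure (gibbsPlan ε α β f g) := isFiniteMeasure_gibbsPlan hε hf hg
  have hac : gibbsPlan ε α β f g ≪ (renorm α).prod (renorm β) :=
    withDensity_absolutelyContinuous _ _
  have hm := geomMass_pos hα hβ
  refine (entropicReg_ne_top_iff hα hβ).2 ⟨hfin, hac, ?_⟩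
  refine Integrable.mono' (integrable_const
    ((2 * B + C) / ε + |Real.log (geomMass (renorm α) (renorm β))|))
    (measurable_llr _ _).aestronglyMeasurable ?_
  filter_upwards [hac.ae_le (rnDeriv_gibbsPlan f g)] with p hp
  rw [llr_def]
  dsimp only
  rw [hp, gibbs, Real.log_div (Real.exp_pos _).ne' hm.ne', Real.log_exp]
  refine (norm_sub_le _ _).trans (add_le_add ?_ le_rfl)
  rw [Real.norm_eq_abs, abs_div, abs_of_pos hε]
  have h1 := abs_le.1 (hf p.1)
  have h2 := abs_le.1 (hg p.2)
  have h3 := cost_nonneg (p.1 : E d) p.2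
  have h4 := hC p.1 p.2
  gcongr
  exact abs_le.2 ⟨by linarith, by linarith⟩

/-- Boundedness of `f` alone does not suffice, as `1 / bdryCost` may blow up at the boundary. But on
the logarithmic branch `bdryCost` is at least `exp (-M / ε) / K`, and on the other branch the ratio
is exactly 1. -/
theorem integrable_min_one_div {ν μ : Measure Ω} [IsFiniteMeasure μ] [IsFiniteMeasure ν]
    (hε : 0 < ε) (hm : 0 < m) (hν : ν ≠ 0) (hw : ∀ x : Ω, 0 < bdryCost Ω x)
    (hwc : Continuous fun x : Ω => bdryCost Ω x) (hwM : ∀ x : Ω, bdryCost Ω x ≤ M)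
    {f g : C(Ω, ℝ)} (hfB : ∀ x, |f x| ≤ B) (hgB : ∀ x, |g x| ≤ B)
    (hf : ∀ x, f x = sinkhorn ε m ν g x) :
    Integrable (fun x : Ω => min 1 (f x / bdryCost Ω x)) μ := by
  have hgB' : ∀ x, g x ≤ B := fun x => (le_abs_self _).trans (hgB x)
  set K := Real.exp (B / ε) / m * ν.real univ
  refine Integrable.mono' (integrable_const (1 + B * (Real.exp (M / ε) * K)))
    (measurable_const.min (f.continuous.measurable.div hwc.measurable)).aestronglyMeasurable
    (ae_of_all _ fun x => ?_)
  have hB : 0 ≤ B := (abs_nonneg _).trans (hfB x)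
  have hwx := hw x
  have hG := gibbsIntegral_pos hε hm hν g.continuous.measurable hgB' x
  have hGK : gibbsIntegral ε m ν g x ≤ K := gibbsIntegral_le hε hm hgB' x
  have hK : 0 < K := hG.trans_le hGK
  rw [Real.norm_eq_abs, abs_le]
  have h0 : 0 ≤ B * (Real.exp (M / ε) * K) := by positivity
  refine ⟨le_min (by linarith) ?_, (min_le_left _ _).trans (by linarith)⟩
  rcases le_total (bdryCost Ω x) (-ε * Real.log (bdryCost Ω x * gibbsIntegral ε m ν g x))
    with h | h
  · rw [hf, sinkhorn, min_eq_left h, div_self hwx.ne']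
    linarith
  · have h1 : Real.exp (-(M / ε)) ≤ bdryCost Ω x * K := by
      refine le_trans ?_ (mul_le_mul_of_nonneg_left hGK hwx.le)
      rw [← Real.le_log_iff_exp_le (mul_pos hwx hG)]
      refine neg_le.1 ((le_div_iff₀ hε).2 ?_)
      linarith [hwM x]
    have h2 : 1 ≤ Real.exp (M / ε) * K * bdryCost Ω x := by
      have := mul_le_mul_of_nonneg_left h1 (Real.exp_pos (M / ε)).le
      rw [← Real.exp_add, add_neg_cancel, Real.exp_zero] at this
      linarith
    have h3 := (abs_le.1 (hfB x)).1
    rw [le_div_iff₀ hwx]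
    nlinarith [mul_le_mul_of_nonneg_left h2 hB]

theorem dualObj_le_primalObj (hε : 0 < ε) (hw : ∀ x : Ω, 0 < bdryCost Ω x)
    (hwc : Continuous fun x : Ω => bdryCost Ω x) (hC : ∃ C, ∀ x y : Ω, cost (x : E d) y ≤ C)
    [IsFiniteMeasure (renorm α)] [IsFiniteMeasure (renorm β)]
    (hα : renorm α ≠ 0) (hβ : renorm β ≠ 0) (π : Measure (Ω × Ω)) [SigmaFinite π]
    (f g : C(Ω, ℝ)) : dualObj ε α β f g ≤ primalObj ε α β π := by
  by_cases hπ : primalObj ε α β π = ∞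
  · rw [hπ, EReal.coe_ennreal_top]
    exact le_top
  by_cases hfg : dualObj ε α β f g = ⊥
  · rw [hfg]
    exact bot_le
  obtain ⟨D, hD, h1, h2, -, h3⟩ := toReal_primalObj_eq_add hε hw hwc hC hα hβ hπ hfg
  rw [hD, ← EReal.coe_ennreal_toReal hπ, EReal.coe_le_coe_iff, h3]
  have h4 := integral_nonneg_of_ae h1
  have h5 := integral_nonneg_of_ae h2
  have h6 := integral_nonneg (μ := (renorm α).prod (renorm β)) (planGap_nonneg hε
    (geomMass_pos hα hβ) f g π ((renorm α).prod (renorm β)))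
  linarith

/-- There are bounded continuous potentials whose Gibbs plan closes the duality gap. -/
theorem exists_dualObj_eq_primalObj (hε : 0 < ε) (hw : ∀ x : Ω, 0 < bdryCost Ω x)
    (hwc : Continuous fun x : Ω => bdryCost Ω x) (hwM : ∃ M, ∀ x : Ω, bdryCost Ω x ≤ M)
    (hC : ∃ C, ∀ x y : Ω, cost (x : E d) y ≤ C)
    [IsFiniteMeasure (renorm α)] [IsFiniteMeasure (renorm β)]
    (hα : renorm α ≠ 0) (hβ : renorm β ≠ 0) :
    ∃ f g : C(Ω, ℝ), IsFiniteMeasure (gibbsPlan ε α β f g) ∧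
      primalObj ε α β (gibbsPlan ε α β f g) ≠ ∞ ∧
      dualObj ε α β f g = primalObj ε α β (gibbsPlan ε α β f g) := by
  obtain ⟨M, hwM⟩ := hwM
  have hm := geomMass_pos hα hβ
  obtain ⟨f, g, B, hfB, hgB, hf, hg⟩ :=
    exists_sinkhorn_fixedPoint (ν := renorm β) (μ := renorm α) hε hm hα hβ hw hwc hwM
  have hfB' : ∀ x, f x ≤ B := fun x => (le_abs_self _).trans (hfB x)
  have hgB' : ∀ x, g x ≤ B := fun x => (le_abs_self _).trans (hgB x)
  have hfin : IsFiniteMeasure (gibbsPlan ε α β f g) := isFiniteMeasure_gibbsPlan hε hfB hgB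
  have hρ1 : (gibbsPlan ε α β f g).map Prod.fst = (renorm α).withDensity fun x =>
      ENNReal.ofReal (Real.exp (f x / ε)
        * gibbsIntegral ε (geomMass (renorm α) (renorm β)) (renorm β) g x) := by
    rw [gibbsPlan, map_fst_withDensity_prod (measurable_gibbsPlan_density _ _ _ _)]
    congr 1
    funext x
    exact lintegral_gibbs_section (ν := renorm β) hε hm g.continuous.measurable hgB' (f x) x
  have hρ2 : (gibbsPlan ε α β f g).map Prod.snd = (renorm β).withDensity fun y =>
      ENNReal.ofReal (Real.exp (g y / ε)
        * gibbsIntegral ε (geomMass (renorm α) (renorm β)) (renorm α) f y) := by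
    rw [gibbsPlan, map_snd_withDensity_prod (measurable_gibbsPlan_density _ _ _ _)]
    congr 1
    funext y
    refine Eq.trans ?_ (lintegral_gibbs_section (ν := renorm α) hε hm f.continuous.measurable
      hfB' (g y) y)
    refine lintegral_congr fun x => ?_
    simp only [gibbs, add_comm (f x), cost_comm (y : E d)]
  obtain ⟨hp1, hg1⟩ := marginal_optimal hε hm hβ hw hwc f.continuous.measurable
    g.continuous.measurable hgB' hf hρ1
  obtain ⟨hp2, hg2⟩ := marginal_optimal hε hm hα hw hwc g.continuous.measurable
    f.continuous.measurable hfB' hg hρ2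
  have hπ : primalObj ε α β (gibbsPlan ε α β f g) ≠ ∞ := primalObj_ne_top hC hp1 hp2
    (entropicReg_gibbsPlan_ne_top hε hC hα hβ hfB hgB)
  have hG : Integrable (fun p => gibbs ε f g p / geomMass (renorm α) (renorm β))
      ((renorm α).prod (renorm β)) := by
    refine Integrable.div_const (Integrable.mono' (integrable_const (Real.exp (2 * B / ε)))
      (continuous_gibbs ε f g).aestronglyMeasurable (ae_of_all _ fun p => ?_)) _
    rw [Real.norm_of_nonneg (by exact (Real.exp_pos _).le)]
    exact gibbs_le hε hfB hgB p
  -- The gap formula needs a finite dual value.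
  have hbot : dualObj ε α β f g ≠ ⊥ := by
    rw [dualObj_eq_coe (integrable_min_one_div hε hm hβ hw hwc hwM hfB hgB hf)
      (integrable_min_one_div hε hm hα hw hwc hwM hgB hfB hg) hG]
    exact EReal.coe_ne_bot _
  refine ⟨f, g, hfin, hπ, ?_⟩
  obtain ⟨D, hD, -, -, -, h3⟩ := toReal_primalObj_eq_add hε hw hwc hC hα hβ hπ hbot
  have hg3 : planGap ε (geomMass (renorm α) (renorm β)) f g (gibbsPlan ε α β f g)
      ((renorm α).prod (renorm β)) =ᵐ[(renorm α).prod (renorm β)] 0 := by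
    filter_upwards [rnDeriv_gibbsPlan (ε := ε) (α := α) (β := β) f g] with p hp
    exact planGap_eq_zero hε hm hp
  rw [integral_eq_zero_of_ae hg1, integral_eq_zero_of_ae hg2, integral_eq_zero_of_ae hg3,
    add_zero, add_zero, add_zero] at h3
  rw [hD, ← h3, EReal.coe_ennreal_toReal hπ]

/-- A zero gap makes all three slack integrals vanish, and the entropy slack vanishes only where the
density is the Gibbs density. No boundedness of the potentials is required, so this applies to any
dual maximizer. -/
theorem eq_gibbsPlan_of_dualObj_eq (hε : 0 < ε) (hw : ∀ x : Ω, 0 < bdryCost Ω x)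
    (hwc : Continuous fun x : Ω => bdryCost Ω x) (hC : ∃ C, ∀ x y : Ω, cost (x : E d) y ≤ C)
    [IsFiniteMeasure (renorm α)] [IsFiniteMeasure (renorm β)]
    (hα : renorm α ≠ 0) (hβ : renorm β ≠ 0) {π : Measure (Ω × Ω)} [SigmaFinite π]
    (hπ : primalObj ε α β π ≠ ∞) {f g : C(Ω, ℝ)}
    (hfg : dualObj ε α β f g = primalObj ε α β π) : π = gibbsPlan ε α β f g := by
  have hbot : dualObj ε α β f g ≠ ⊥ := by
    rw [hfg]
    exact EReal.coe_ennreal_ne_bot _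
  obtain ⟨D, hD, h1, h2, hint, h3⟩ := toReal_primalObj_eq_add hε hw hwc hC hα hβ hπ hbot
  rw [hD, ← EReal.coe_ennreal_toReal hπ, EReal.coe_eq_coe_iff] at hfg
  have hm := geomMass_pos hα hβ
  obtain ⟨-, hac, -⟩ :=
    (entropicReg_ne_top_iff hα hβ).1 (ne_top_of_primalObj_ne_top hε hπ).2.2.2
  set P := (renorm α).prod (renorm β) with hP
  have hnn := planGap_nonneg hε hm f g π P
  have h4 := integral_nonneg_of_ae h1
  have h5 := integral_nonneg_of_ae h2
  have h6 := integral_nonneg (μ := P) hnn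
  have h7 := (integral_eq_zero_iff_of_nonneg hnn hint).1 (by linarith)
  rw [← Measure.withDensity_rnDeriv_eq π P hac, gibbsPlan]
  refine withDensity_congr_ae ?_
  filter_upwards [h7, Measure.rnDeriv_lt_top π P] with p hp hpt
  rw [← ENNReal.ofReal_toReal hpt.ne]
  congr 1
  by_contra hne
  exact (planGap_pos hε hm hne).ne' hp

end Optimality

end ROTB

theorem mainTheorem11 {d : ℕ} (hd : 0 < d) (Ω : Set (EuclideanSpace ℝ (Fin d)))
    (hΩ_open : IsOpen Ω) (hΩ_bdd : Bornology.IsBounded Ω)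
    (ε : ℝ) (hε : 0 < ε) (α β : Measure Ω)
    (hα : ROTB.FinitePersistence α) (hβ : ROTB.FinitePersistence β)
    (hα0 : α ≠ 0) (hβ0 : β ≠ 0) :
    ((ROTB.FG ε α β : ℝ≥0∞) : EReal)
        = ⨆ (f : C(Ω, ℝ)) (g : C(Ω, ℝ)), ROTB.dualObj ε α β f g ∧
      ∀ f g : C(Ω, ℝ), ROTB.IsDualOptimal ε α β f g →
        ROTB.IsPrimalOptimal ε α β (ROTB.gibbsPlan ε α β f g) := by
  have hne : Ω.Nonempty := by
    by_contra h
    have : IsEmpty Ω := isEmpty_coe_sort.2 (not_nonempty_iff_eq_empty.1 h)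
    exact hα0 (Measure.eq_zero_of_isEmpty α)
  have hfr := ROTB.nonempty_frontier hd hΩ_bdd hne
  have hw := ROTB.bdryCost_pos hfr hΩ_open
  have hwc := ROTB.continuous_bdryCost hfr
  have hwM := ROTB.exists_bdryCost_le hfr hΩ_bdd
  have hC := ROTB.exists_cost_le hΩ_bdd
  have : IsFiniteMeasure (ROTB.renorm α) := ROTB.isFiniteMeasure_renorm hα
  have : IsFiniteMeasure (ROTB.renorm β) := ROTB.isFiniteMeasure_renorm hβ
  have hα' := ROTB.renorm_ne_zero hw hwc hα0
  have hβ' := ROTB.renorm_ne_zero hw hwc hβ0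
  obtain ⟨f₀, g₀, hfin, hπ, h₀⟩ := ROTB.exists_dualObj_eq_primalObj hε hw hwc hwM hC hα' hβ'
  have hweak : ∀ (π : Measure (Ω × Ω)) [IsLocallyFiniteMeasure π] (f g : C(Ω, ℝ)),
      ROTB.dualObj ε α β f g ≤ ROTB.primalObj ε α β π := fun π _ f g =>
    ROTB.dualObj_le_primalObj hε hw hwc hC hα' hβ' π f g
  have hFG : ROTB.FG ε α β = ROTB.primalObj ε α β (ROTB.gibbsPlan ε α β f₀ g₀) := by
    have hlf : IsLocallyFiniteMeasure (ROTB.gibbsPlan ε α β f₀ g₀) := inferInstance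
    refine le_antisymm (iInf₂_le (ROTB.gibbsPlan ε α β f₀ g₀) hlf) (le_iInf₂ fun π hlf => ?_)
    rw [← EReal.coe_ennreal_le_coe_ennreal_iff, ← h₀]
    exact hweak π f₀ g₀
  refine ⟨?_, fun f g hfg => ?_⟩
  · rw [hFG]
    refine le_antisymm ?_ (iSup₂_le fun f g => hweak _ f g)
    rw [← h₀]
    exact le_iSup₂ (f := fun f g => ROTB.dualObj ε α β f g) f₀ g₀
  -- The maximizer is squeezed between the constructed pair's value and the equal primal value, so
  -- the constructed plan is also the Gibbs plan of `(f, g)`.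
  · have h := le_antisymm (hweak (ROTB.gibbsPlan ε α β f₀ g₀) f g) (h₀ ▸ hfg f₀ g₀)
    rw [← ROTB.eq_gibbsPlan_of_dualObj_eq hε hw hwc hC hα' hβ' hπ h]
    exact ⟨inferInstance, hFG.symm⟩
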